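/- Let $\mathcal H$ be a complex Hilbert space, $P_+$ an orthogonal projection on $\mathcal H$, and $\mathcal B_2$ the space of Hilbert--Schmidt operators on $\mathcal H$, with norm $\|\cdot\|_2$ and inner product $\mathrm{Re}\,\mathrm{Tr}(X^*Y)$; let $\mathcal B_{2,ah}\subset\mathcal B_2$ be the real Hilbert space of anti-Hermitian elements. Let $$\mathcal R_2^+=\{(P,f): P \text{ an orthogonal projection},\ P-P_+\in\mathcal B_2,\ \mathrm{index}(PP_+:R(P_+)\to R(P))=0,\ Pf=f,\ \|f\|=1\},$$ embedded as a submanifold of $\mathcal B_2\times\mathcal H$ by $(P,f)\mapsto(P-P_+,f)$. For $p=(P,f)\in\mathcal R_2^+$ let $\delta_p(Z)=(ZP-PZ,Zf)$ for $Z\in\mathcal B_{2,ah}$. The tangent space is $T_p=\delta_p(\mathcal B_{2,ah})$. Let $\mathbb H_p\subset\mathcal B_{2,ah}$ be the horizontal space of those $Z$ whose second and third diagonal blocks in the decomposition $\mathcal H=\langle f\rangle\oplus(R(P)\ominus\langle f\rangle)\oplus N(P)$ vanish; then $\delta_p:\mathbb H_p\to T_p$ is bijective, with inverse denoted $\kappa_p$,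 and the quotient Riemannian metric on $\mathcal R_2^+$ is given by $|V|_p=\|\kappa_p V\|_2$. Geodesics are the smooth curves that are critical for the energy of this metric on every compact interval, and $\mathrm{Exp}_p(V)$ is the value at time $1$ of the geodesic starting at $p$ with velocity $V$. Then the function $\frac{\sin t}{t}+\frac{\cos t-1}{t^2}$ has a first positive zero $r_0$, and $r_0/2>\pi/4$. For every $p=(P,f)\in\mathcal R_2^+$: 1. For every $V\in T_p$ there is a unique geodesic $\gamma:\mathbb R\to\mathcal R_2^+$ with $\gamma(0)=p$ and $\dot\gamma(0)=V$, and $\mathrm{Exp}_p(V)=(e^{Z}Pe^{-Z},e^{Z}f)$ with $Z=\kappa_pV$. 2. For every $V\in T_p$ with $|V|_p<r_0/2$, the map $\mathrm{Exp}_p:T_p\to\mathcal R_2^+$ is differentiable at $V$ and its differential is an isomorphism (linear, bounded with bounded inverse) from $T_p$ onto $T_{\mathrm{Exp}_p(V)}$. 3. For every $Z\in\mathbb H_p$, with $\mathrm{ad}\,Z(W)=ZW-WZ$ on $\mathcal B_{2,ah}$ and $F(\lambda)=\frac{1-e^{-\lambda}}{\lambda}$, the operator $F(\mathrm{ad}\,Z)$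 is a normal contraction on $\mathcal B_{2,ah}$, and if the operator norm of $Z$ is less than $r_0/2$, then $\|F(\mathrm{ad}\,Z)-1\|<1$. -/

import Mathlib

open scoped ContDiff ENNReal InnerProductSpace

noncomputable section

namespace SphereBundle

section HilbertSchmidt

variable (H : Type*) [NormedAddCommGroup H] [InnerProductSpace ℂ H] [CompleteSpace H]

/-- Index set of a fixed orthonormal (Hilbert) basis of `H`. -/
def basisIndex : Set H := (exists_hilbertBasis ℂ H).choose

/-- A fixed orthonormal (Hilbert) basis `(eᵢ)` of `H`. -/
def basis : HilbertBasis (basisIndex H) ℂ H := (exists_hilbertBasis ℂ H).choose_spec.choose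

/-- The Hilbert-Schmidt operators `B₂(H)`: bounded operators `T` with `∑ ‖T eᵢ‖² < ∞`.
Neither this condition nor the value of the sum depends on the orthonormal basis. -/
def hsSubmodule : Submodule ℂ (H →L[ℂ] H) where
  carrier := {T | Memℓp (fun i : basisIndex H => T (basis H i)) 2}
  add_mem' := fun hS hT => hS.add hT
  zero_mem' := zero_memℓp
  smul_mem' := fun c _ hT => hT.const_smul c

/-- `B₂(H)` as a type of its own, so that it carries the Hilbert-Schmidt norm
and not the operator norm inherited from `H →L[ℂ] H`. -/
def HSOp : Type _ := hsSubmodule H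

instance : AddCommGroup (HSOp H) := inferInstanceAs (AddCommGroup (hsSubmodule H))
instance : Module ℂ (HSOp H) := inferInstanceAs (Module ℂ (hsSubmodule H))

variable {H}

/-- The bounded operator underlying a Hilbert-Schmidt operator. -/
def HSOp.op : HSOp H →ₗ[ℂ] (H →L[ℂ] H) := (hsSubmodule H).subtype

theorem HSOp.op_injective : Function.Injective (HSOp.op (H := H)) := Subtype.val_injective

/-- A bounded operator satisfying the Hilbert-Schmidt condition, as an element of `B₂(H)`. -/
def HSOp.mk (T : H →L[ℂ] H) (hT : T ∈ hsSubmodule H) : HSOp H := ⟨T, hT⟩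

@[simp] theorem HSOp.op_mk (T : H →L[ℂ] H) (hT : T ∈ hsSubmodule H) : (HSOp.mk T hT).op = T := rfl

theorem HSOp.op_mem (T : HSOp H) : T.op ∈ hsSubmodule H := T.2

/-- The embedding `T ↦ (T eᵢ)ᵢ` of `B₂(H)` in the Hilbert sum `ℓ²(H)`. -/
def HSOp.toLp : HSOp H →ₗ[ℂ] lp (fun _ : basisIndex H => H) 2 where
  toFun T := ⟨fun i => T.op (basis H i), T.2⟩
  map_add' _ _ := rfl
  map_smul' _ _ := rfl

theorem HSOp.toLp_injective : Function.Injective (HSOp.toLp (H := H)) := by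
  intro S T h
  apply HSOp.op_injective
  have hi : ∀ i, S.op (basis H i) = T.op (basis H i) := fun i =>
    congrFun (congrArg Subtype.val h) i
  refine ContinuousLinearMap.ext_on (s := Set.range (basis H)) ?_ ?_
  · rw [Submodule.dense_iff_topologicalClosure_eq_top]
    exact (basis H).dense_span
  · rintro _ ⟨i, rfl⟩
    exact hi i

/-- The Hilbert-Schmidt norm `‖T‖₂ = (∑ ‖T eᵢ‖²)^(1/2)`. -/
instance : NormedAddCommGroup (HSOp H) :=
  NormedAddCommGroup.induced (HSOp H) _ HSOp.toLp HSOp.toLp_injective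

/-- The trace inner product `Tr(S* T) = ∑ ⟪S eᵢ, T eᵢ⟫`. -/
instance : InnerProductSpace ℂ (HSOp H) := InnerProductSpace.induced HSOp.toLp
/-- The real part of the trace inner product. -/
instance : InnerProductSpace ℝ (HSOp H) := InnerProductSpace.complexToReal


/-- Parseval's identity. -/
theorem enorm_sq_eq_tsum (x : H) : ‖x‖ₑ ^ 2 = ∑' i, ‖inner ℂ (basis H i) x‖ₑ ^ 2 := by
  have h := lp.hasSum_norm (p := 2) (by norm_num) ((basis H).repr x)
  have h2 : HasSum (fun i => ‖inner ℂ (basis H i) x‖ ^ 2) (‖x‖ ^ 2) := by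
    simpa [(basis H).repr_apply_apply] using h
  have h3 := ENNReal.ofReal_tsum_of_nonneg (fun i => by positivity) h2.summable
  rw [h2.tsum_eq] at h3
  simpa [ENNReal.ofReal_pow, ofReal_norm] using h3

/-- The sum `∑ ‖T eᵢ‖²` as an extended nonnegative real. -/
def hsSum (T : H →L[ℂ] H) : ℝ≥0∞ := ∑' i, ‖T (basis H i)‖ₑ ^ 2

theorem mem_hsSubmodule_iff (T : H →L[ℂ] H) : T ∈ hsSubmodule H ↔ hsSum T ≠ ⊤ := by
  change Memℓp (fun i : basisIndex H => T (basis H i)) 2 ↔ _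
  rw [memℓp_gen_iff (by norm_num)]
  have e : ∀ i, ‖T (basis H i)‖ₑ ^ 2 = ((‖T (basis H i)‖₊ ^ 2 : NNReal) : ℝ≥0∞) := by
    intro i; rw [ENNReal.coe_pow]; rfl
  unfold hsSum
  simp_rw [e]
  rw [ENNReal.tsum_coe_ne_top_iff_summable, ← NNReal.summable_coe]
  simp

theorem hsSum_star (T : H →L[ℂ] H) : hsSum (star T) = hsSum T := by
  unfold hsSum
  rw [tsum_congr fun i => enorm_sq_eq_tsum (star T (basis H i)),
    tsum_congr fun i => enorm_sq_eq_tsum (T (basis H i)), ENNReal.tsum_comm]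
  refine tsum_congr fun i => tsum_congr fun j => ?_
  rw [ContinuousLinearMap.star_eq_adjoint, ContinuousLinearMap.adjoint_inner_right,
    ← inner_conj_symm, ← ofReal_norm, ← ofReal_norm, RCLike.norm_conj]

theorem hsSum_mul_le (A T : H →L[ℂ] H) : hsSum (A * T) ≤ ‖A‖ₑ ^ 2 * hsSum T := by
  unfold hsSum
  rw [← ENNReal.tsum_mul_left]
  refine ENNReal.tsum_le_tsum fun i => ?_
  rw [← mul_pow]
  gcongr
  exact A.le_opENorm _

theorem hsSum_mul_le' (T A : H →L[ℂ] H) : hsSum (T * A) ≤ ‖A‖ₑ ^ 2 * hsSum T := by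
  rw [← hsSum_star, star_mul]
  refine (hsSum_mul_le _ _).trans ?_
  rw [hsSum_star, ← ofReal_norm, ← ofReal_norm, norm_star]

theorem mul_mem_hs_left (A : H →L[ℂ] H) {T : H →L[ℂ] H} (hT : T ∈ hsSubmodule H) :
    A * T ∈ hsSubmodule H := by
  rw [mem_hsSubmodule_iff] at *
  exact ne_top_of_le_ne_top (ENNReal.mul_ne_top (by simp) hT) (hsSum_mul_le A T)

theorem mul_mem_hs_right {T : H →L[ℂ] H} (A : H →L[ℂ] H) (hT : T ∈ hsSubmodule H) :
    T * A ∈ hsSubmodule H := by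
  rw [mem_hsSubmodule_iff] at *
  exact ne_top_of_le_ne_top (ENNReal.mul_ne_top (by simp) hT) (hsSum_mul_le' T A)

theorem HSOp.enorm_sq (T : HSOp H) : ‖T‖ₑ ^ 2 = hsSum T.op := by
  have h : HasSum (fun i => ‖T.op (basis H i)‖ ^ 2) (‖T‖ ^ 2) := by
    have := lp.hasSum_norm (p := 2) (by norm_num) (HSOp.toLp T)
    simp only [ENNReal.toReal_ofNat, Real.rpow_ofNat] at this
    exact this
  have h3 := ENNReal.ofReal_tsum_of_nonneg (fun i => by positivity) h.summable
  rw [h.tsum_eq] at h3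
  simpa [ENNReal.ofReal_pow, ofReal_norm, hsSum] using h3

theorem norm_le_of_enorm_sq_le {E F : Type*} [SeminormedAddGroup E] [SeminormedAddGroup F]
    {x : E} {y : F} {c : ℝ} (hc : 0 ≤ c)
    (h : ‖x‖ₑ ^ 2 ≤ ENNReal.ofReal c ^ 2 * ‖y‖ₑ ^ 2) : ‖x‖ ≤ c * ‖y‖ := by
  rw [← mul_pow, ENNReal.pow_le_pow_left_iff two_ne_zero, ← ofReal_norm, ← ofReal_norm,
    ← ENNReal.ofReal_mul hc, ENNReal.ofReal_le_ofReal_iff (by positivity)] at h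
  exact h

/-- The operator norm is at most the Hilbert-Schmidt norm. -/
theorem HSOp.opNorm_le (T : HSOp H) : ‖T.op‖ ≤ ‖T‖ := by
  rw [← norm_star]
  refine ContinuousLinearMap.opNorm_le_bound _ (norm_nonneg _) fun x => ?_
  refine norm_le_of_enorm_sq_le (norm_nonneg _) ?_
  rw [ofReal_norm, HSOp.enorm_sq, enorm_sq_eq_tsum, hsSum, ← ENNReal.tsum_mul_right]
  refine ENNReal.tsum_le_tsum fun i => ?_
  rw [← mul_pow]
  gcongr
  rw [ContinuousLinearMap.star_eq_adjoint, ContinuousLinearMap.adjoint_inner_right]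
  rw [← ofReal_norm, ← ofReal_norm, ← ofReal_norm, ← ENNReal.ofReal_mul (norm_nonneg _)]
  exact ENNReal.ofReal_le_ofReal (norm_inner_le_norm _ _)

/-- The inclusion of `B₂(H)` in the bounded operators is continuous. -/
def HSOp.opL : HSOp H →L[ℂ] (H →L[ℂ] H) :=
  HSOp.op.mkContinuous 1 fun T => by simpa using HSOp.opNorm_le T

@[simp] theorem HSOp.opL_apply (T : HSOp H) : HSOp.opL T = T.op := rfl

instance : CompleteSpace (HSOp H) := by
  refine Metric.complete_of_cauchySeq_tendsto fun u hu => ?_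
  have hiso : Isometry (HSOp.toLp (H := H)) :=
    AddMonoidHomClass.isometry_of_norm _ fun _ => rfl
  obtain ⟨a, ha⟩ := cauchySeq_tendsto_of_complete (hiso.uniformContinuous.comp_cauchySeq hu)
  obtain ⟨T, hT⟩ := cauchySeq_tendsto_of_complete
    (HSOp.opL.uniformContinuous.comp_cauchySeq hu)
  have hi : ∀ i, T (basis H i) = a i := fun i => by
    have h1 : Filter.Tendsto (fun n => (u n).op (basis H i)) Filter.atTop
        (nhds (T (basis H i))) :=
      ((ContinuousLinearMap.apply ℂ H (basis H i)).continuous.tendsto T).comp hT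
    have h2 : Filter.Tendsto (fun n => (u n).op (basis H i)) Filter.atTop (nhds (a i)) := by
      have := (lp.evalCLM ℂ (fun _ : basisIndex H => H) 2 i).continuous.tendsto a
      exact this.comp ha
    exact tendsto_nhds_unique h1 h2
  have hmem : T ∈ hsSubmodule H := by
    change Memℓp (fun i : basisIndex H => T (basis H i)) 2
    simp_rw [hi]
    exact lp.memℓp a
  refine ⟨HSOp.mk T hmem, ?_⟩
  rw [hiso.isEmbedding.tendsto_nhds_iff]
  have : HSOp.toLp (HSOp.mk T hmem) = a := by
    ext i
    exact hi i
  rw [this]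
  exact ha

variable (H) in
/-- The real Hilbert space `B₂(H)_ah` of anti-Hermitian Hilbert-Schmidt operators. -/
def skewHS : Submodule ℝ (HSOp H) where
  carrier := {Z | star Z.op = -Z.op}
  add_mem' := fun {a b} ha hb => by
    simp only [Set.mem_ofPred_eq, map_add, star_add] at *
    rw [ha, hb]; abel
  zero_mem' := by simp
  smul_mem' := fun c a ha => by
    have e : (c • a).op = c • a.op := HSOp.op.map_smul_of_tower c a
    simp only [Set.mem_ofPred_eq] at *
    rw [e, star_smul, ha]; simp

theorem mem_skewHS_iff (X : HSOp H) : X ∈ skewHS H ↔ star X.op = -X.op := Iff.rfl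

theorem skewHS_star (Z : skewHS H) : star Z.1.op = -Z.1.op := Z.2

instance : CompleteSpace (skewHS H) := by
  have h : IsClosed (skewHS H : Set (HSOp H)) :=
    isClosed_eq (continuous_star.comp HSOp.opL.continuous) HSOp.opL.continuous.neg
  exact h.completeSpace_coe

theorem commutator_mem (Z W : skewHS H) :
    Z.1.op * W.1.op - W.1.op * Z.1.op ∈ hsSubmodule H :=
  sub_mem (mul_mem_hs_left _ W.1.op_mem) (mul_mem_hs_left _ Z.1.op_mem)

theorem commutator_skew (Z W : skewHS H) :
    HSOp.mk _ (commutator_mem Z W) ∈ skewHS H := by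
  rw [mem_skewHS_iff, HSOp.op_mk, star_sub, star_mul, star_mul, skewHS_star, skewHS_star]
  simp only [neg_mul_neg, neg_sub]

theorem op_smul_real (c : ℝ) (X : HSOp H) : (c • X).op = c • X.op :=
  HSOp.op.map_smul_of_tower c X

/-- `ad Z (W) = Z W - W Z` on `B₂(H)_ah`, as a linear map. -/
def adLin (Z : skewHS H) : skewHS H →ₗ[ℝ] skewHS H where
  toFun W := ⟨HSOp.mk _ (commutator_mem Z W), commutator_skew Z W⟩
  map_add' V W := by
    apply Subtype.ext; apply HSOp.op_injective
    simp only [Submodule.coe_add, map_add, HSOp.op_mk, mul_add, add_mul]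
    abel
  map_smul' c W := by
    apply Subtype.ext; apply HSOp.op_injective
    simp only [RingHom.id_apply, Submodule.coe_smul, op_smul_real, HSOp.op_mk, smul_sub,
      mul_smul_comm, smul_mul_assoc]

theorem HSOp.norm_mk_mul_le (A : H →L[ℂ] H) (T : HSOp H) :
    ‖HSOp.mk (A * T.op) (mul_mem_hs_left A T.op_mem)‖ ≤ ‖A‖ * ‖T‖ := by
  refine norm_le_of_enorm_sq_le (norm_nonneg _) ?_
  rw [ofReal_norm, HSOp.enorm_sq, HSOp.enorm_sq]
  exact hsSum_mul_le _ _

theorem HSOp.norm_mk_mul_le' (T : HSOp H) (A : H →L[ℂ] H) :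
    ‖HSOp.mk (T.op * A) (mul_mem_hs_right A T.op_mem)‖ ≤ ‖A‖ * ‖T‖ := by
  refine norm_le_of_enorm_sq_le (norm_nonneg _) ?_
  rw [ofReal_norm, HSOp.enorm_sq, HSOp.enorm_sq]
  exact hsSum_mul_le' _ _

/-- `ad Z (W) = Z W - W Z` on `B₂(H)_ah`, as a bounded operator. -/
def ad (Z : skewHS H) : skewHS H →L[ℝ] skewHS H :=
  (adLin Z).mkContinuous (2 * ‖Z.1.op‖) fun W => by
    have h : (adLin Z W).1 = HSOp.mk _ (mul_mem_hs_left Z.1.op W.1.op_mem)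
        - HSOp.mk _ (mul_mem_hs_right Z.1.op W.1.op_mem) := rfl
    change ‖(adLin Z W).1‖ ≤ 2 * ‖Z.1.op‖ * ‖W.1‖
    rw [h]
    refine (norm_sub_le _ _).trans ?_
    linarith [HSOp.norm_mk_mul_le Z.1.op W.1, HSOp.norm_mk_mul_le' W.1 Z.1.op]

/-- `F(A)` for the entire function `F(z) = (1 - e^(-z)) / z = ∑ (-1)ⁿ zⁿ / (n+1)!`. -/
def expQuotient (A : skewHS H →L[ℝ] skewHS H) : skewHS H →L[ℝ] skewHS H :=
  ∑' n : ℕ, ((-1 : ℝ) ^ n / ((n + 1).factorial : ℝ)) • A ^ n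

theorem rankOne_mem (x y : H) : InnerProductSpace.rankOne ℂ x y ∈ hsSubmodule H := by
  rw [mem_hsSubmodule_iff]
  unfold hsSum
  have : ∀ i, ‖InnerProductSpace.rankOne ℂ x y (basis H i)‖ₑ ^ 2
      = ‖inner ℂ (basis H i) y‖ₑ ^ 2 * ‖x‖ₑ ^ 2 := fun i => by
    rw [InnerProductSpace.rankOne_apply, enorm_smul, mul_pow, ← inner_conj_symm,
      ← ofReal_norm (starRingEnd ℂ _), RCLike.norm_conj, ofReal_norm]
  rw [tsum_congr this, ENNReal.tsum_mul_right, ← enorm_sq_eq_tsum]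
  exact ENNReal.mul_ne_top (by simp) (by simp)

end HilbertSchmidt

section Bundle

variable {H : Type*} [NormedAddCommGroup H] [InnerProductSpace ℂ H] [CompleteSpace H]

/-- The operator `QP : R(P) → R(Q)` for a pair of projections `(P, Q)`. -/
def pairMap (P Q : H →L[ℂ] H) : P.range →ₗ[ℂ] Q.range :=
  ((Q ∘L P).toLinearMap.domRestrict P.range).codRestrict Q.range fun x => ⟨P x, rfl⟩

/-- The index of the pair of projections `(P, Q)`: the Fredholm index
`dim ker A - dim coker A` of `A = QP : R(P) → R(Q)`. When `Q - P` is Hilbert-Schmidt,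
`A` is Fredholm and both dimensions are finite. -/
def projIndex (P Q : H →L[ℂ] H) : ℤ :=
  (Module.finrank ℂ (pairMap P Q).ker : ℤ)
    - Module.finrank ℂ (Q.range ⧸ (pairMap P Q).range)

/-- The total space `R₂⁺` of the sphere bundle over the zero index component of the restricted
Grassmannian of `Pp`: pairs of an orthogonal projection `P` with `P - Pp` Hilbert-Schmidt and
index of `(Pp, P)` zero, and a unit vector `f` in the range of `P`. -/
@[ext]
structure RestrictedBundle (Pp : H →L[ℂ] H) where
  P : H →L[ℂ] H
  f : H
  isStarProjection : IsStarProjection P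
  sub_mem : P - Pp ∈ hsSubmodule H
  index_eq_zero : projIndex Pp P = 0
  apply_eq : P f = f
  norm_eq_one : ‖f‖ = 1

variable {Pp : H →L[ℂ] H}

/-- The embedding `(P, f) ↦ (P - Pp, f)` of `R₂⁺` as a submanifold of the Hilbert space
`B₂(H) × H` (the product norm used here is equivalent to the Hilbert norm). Smoothness and
differentials of maps from and to `R₂⁺` are those of the composites with this embedding. -/
def RestrictedBundle.emb (p : RestrictedBundle Pp) : HSOp H × H := (HSOp.mk (p.P - Pp) p.sub_mem, p.f)

/-- `δ_p (Z) = (ZP - PZ, Zf)`, the differential at `1` of `U ↦ U • p = (U P U*, U f)`. -/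
def delta (p : RestrictedBundle Pp) : skewHS H →ₗ[ℝ] HSOp H × H where
  toFun Z := (HSOp.mk (Z.1.op * p.P - p.P * Z.1.op)
    (_root_.sub_mem (mul_mem_hs_right _ Z.1.op_mem) (mul_mem_hs_left _ Z.1.op_mem)), Z.1.op p.f)
  map_add' V W := by
    refine Prod.ext (HSOp.op_injective ?_) ?_
    · simp only [Submodule.coe_add, map_add, HSOp.op_mk, mul_add, add_mul, Prod.fst_add]
      abel
    · simp
  map_smul' c W := by
    refine Prod.ext (HSOp.op_injective ?_) ?_
    · simp only [RingHom.id_apply, Submodule.coe_smul, op_smul_real, HSOp.op_mk, smul_sub,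
        mul_smul_comm, smul_mul_assoc, Prod.smul_fst]
    · simp

/-- The tangent space of `R₂⁺` at `p`, the range of `δ_p`. -/
def tangentSpace (p : RestrictedBundle Pp) : Submodule ℝ (HSOp H × H) := LinearMap.range (delta p)

/-- The orthogonal projection `f ⊗ f` onto the line spanned by `f`. -/
def lineProj (p : RestrictedBundle Pp) : H →L[ℂ] H := InnerProductSpace.rankOne ℂ p.f p.f

/-- The horizontal space at `p`: the anti-Hermitian Hilbert-Schmidt operators whose second and
third diagonal blocks with respect to `H = ⟨f⟩ ⊕ (R(P) ⊖ ⟨f⟩) ⊕ N(P)` vanish. -/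
def horizontalSpace (p : RestrictedBundle Pp) : Submodule ℝ (skewHS H) where
  carrier := {Z | (p.P - lineProj p) * Z.1.op * (p.P - lineProj p) = 0 ∧
      (1 - p.P) * Z.1.op * (1 - p.P) = 0}
  add_mem' := by
    rintro V W ⟨h1, h2⟩ ⟨h3, h4⟩
    constructor
    · rw [Submodule.coe_add, map_add, mul_add, add_mul, h1, h3, add_zero]
    · rw [Submodule.coe_add, map_add, mul_add, add_mul, h2, h4, add_zero]
  zero_mem' := by constructor <;> simp
  smul_mem' := by
    rintro c V ⟨h1, h2⟩
    constructor
    · rw [Submodule.coe_smul, op_smul_real, mul_smul_comm, smul_mul_assoc, h1, smul_zero]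
    · rw [Submodule.coe_smul, op_smul_real, mul_smul_comm, smul_mul_assoc, h2, smul_zero]

section Lift

variable (p : RestrictedBundle Pp)

theorem P_mul_P : p.P * p.P = p.P := p.isStarProjection.isIdempotentElem
theorem P_star : star p.P = p.P := p.isStarProjection.isSelfAdjoint

theorem P_mul_rankOne (x y : H) : p.P * InnerProductSpace.rankOne ℂ x y
    = InnerProductSpace.rankOne ℂ (p.P x) y := by
  ext z; simp

theorem star_rankOne (x y : H) : star (InnerProductSpace.rankOne ℂ x y)
    = InnerProductSpace.rankOne ℂ y x := by
  rw [ContinuousLinearMap.star_eq_adjoint, InnerProductSpace.adjoint_rankOne]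

theorem rankOne_mul_P (x y : H) : InnerProductSpace.rankOne ℂ x y * p.P
    = InnerProductSpace.rankOne ℂ x (p.P y) := by
  rw [← star_star (InnerProductSpace.rankOne ℂ x y * p.P), star_mul, P_star, star_rankOne,
    P_mul_rankOne, star_rankOne]

theorem P_mul_line : p.P * lineProj p = lineProj p := by
  rw [lineProj, P_mul_rankOne, p.apply_eq]
theorem line_mul_P : lineProj p * p.P = lineProj p := by
  rw [lineProj, rankOne_mul_P, p.apply_eq]
theorem line_star : star (lineProj p) = lineProj p := star_rankOne _ _
theorem line_apply : lineProj p p.f = p.f := by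
  simp [lineProj, p.norm_eq_one]
theorem mul_line_eq_zero {A : H →L[ℂ] H} (h : A p.f = 0) : A * lineProj p = 0 := by
  ext z; simp [lineProj, h]
theorem line_mul_line : lineProj p * lineProj p = lineProj p := by
  ext z; simp [lineProj, p.norm_eq_one]

theorem compl_mul_compl : (1 - p.P) * (1 - p.P) = 1 - p.P := by
  rw [mul_sub, sub_mul, sub_mul, P_mul_P]; simp
theorem mid_mul_mid : (p.P - lineProj p) * (p.P - lineProj p) = p.P - lineProj p := by
  rw [mul_sub, sub_mul, sub_mul, P_mul_P, P_mul_line, line_mul_P, line_mul_line]; simp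
theorem mid_mul_compl : (p.P - lineProj p) * (1 - p.P) = 0 := by
  rw [sub_mul, mul_sub, mul_sub, P_mul_P, line_mul_P]; simp
theorem compl_mul_mid : (1 - p.P) * (p.P - lineProj p) = 0 := by
  rw [mul_sub, sub_mul, sub_mul, P_mul_P, P_mul_line]; simp
theorem mid_mul_P : (p.P - lineProj p) * p.P = p.P - lineProj p := by
  rw [sub_mul, P_mul_P, line_mul_P]
theorem P_mul_mid : p.P * (p.P - lineProj p) = p.P - lineProj p := by
  rw [mul_sub, P_mul_P, P_mul_line]
theorem compl_mul_P : (1 - p.P) * p.P = 0 := by rw [sub_mul, P_mul_P]; simp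
theorem P_mul_compl : p.P * (1 - p.P) = 0 := by rw [mul_sub, P_mul_P]; simp
theorem mid_apply : (p.P - lineProj p) p.f = 0 := by simp [p.apply_eq, line_apply]
theorem compl_apply : (1 - p.P) p.f = 0 := by simp [p.apply_eq]

/-- The vertical component of an operator. -/
def vertOp (A : H →L[ℂ] H) : H →L[ℂ] H :=
  (p.P - lineProj p) * A * (p.P - lineProj p) + (1 - p.P) * A * (1 - p.P)

theorem vertOp_mem (W : skewHS H) : vertOp p W.1.op ∈ hsSubmodule H :=
  add_mem (mul_mem_hs_right _ (mul_mem_hs_left _ W.1.op_mem))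
    (mul_mem_hs_right _ (mul_mem_hs_left _ W.1.op_mem))

theorem vertOp_skew (W : skewHS H) : HSOp.mk _ (vertOp_mem p W) ∈ skewHS H := by
  rw [mem_skewHS_iff, HSOp.op_mk, vertOp]
  simp only [star_add, star_mul, star_sub, P_star, line_star, star_one, skewHS_star]
  noncomm_ring

theorem delta_eq_zero_iff (Z : skewHS H) :
    delta p Z = 0 ↔ Z.1.op * p.P = p.P * Z.1.op ∧ Z.1.op p.f = 0 := by
  rw [Prod.ext_iff, ← HSOp.op_injective.eq_iff]
  simp [delta, sub_eq_zero]

theorem delta_vertOp (W : skewHS H) : delta p ⟨HSOp.mk _ (vertOp_mem p W), vertOp_skew p W⟩ = 0 := by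
  rw [delta_eq_zero_iff]
  simp only [HSOp.op_mk, vertOp]
  constructor
  · rw [add_mul, mul_add, mul_assoc _ _ p.P, mul_assoc _ _ p.P, mid_mul_P, compl_mul_P,
      ← mul_assoc p.P, ← mul_assoc p.P, ← mul_assoc p.P, ← mul_assoc p.P, P_mul_mid, P_mul_compl]
    simp
  · rw [_root_.add_apply, ContinuousLinearMap.mul_def _ (p.P - lineProj p),
      ContinuousLinearMap.mul_def _ (1 - p.P), ContinuousLinearMap.comp_apply,
      ContinuousLinearMap.comp_apply, mid_apply, compl_apply]
    simp

theorem sub_compress {R : Type*} [Ring R] {q r : R} (hq : q * q = q) (hqr : q * r = 0) (a : R) :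
    q * (a - (q * a * q + r * a * r)) * q = 0 := by
  have h1 : q * (q * a * q) * q = q * a * q := by
    simp only [mul_assoc, hq]; simp only [← mul_assoc, hq]
  have h2 : q * (r * a * r) * q = 0 := by
    simp only [← mul_assoc, hqr, zero_mul]
  rw [mul_sub, sub_mul, mul_add, add_mul, h1, h2]; simp

theorem horizontal_sub (W : skewHS H) :
    W - ⟨HSOp.mk _ (vertOp_mem p W), vertOp_skew p W⟩ ∈ horizontalSpace p := by
  have e : (W - (⟨HSOp.mk _ (vertOp_mem p W), vertOp_skew p W⟩ : skewHS H)).1.op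
      = W.1.op - vertOp p W.1.op := rfl
  constructor
  · rw [e]
    exact sub_compress (mid_mul_mid p) (mid_mul_compl p) (W.1.op)
  · rw [e, vertOp, add_comm]
    exact sub_compress (compl_mul_compl p) (compl_mul_mid p) (W.1.op)

theorem horizontal_inj (Z : skewHS H) (hZ : Z ∈ horizontalSpace p) (h : delta p Z = 0) : Z = 0 := by
  obtain ⟨h1, h2⟩ := hZ
  obtain ⟨h3, h4⟩ := (delta_eq_zero_iff p Z).1 h
  have h5 := mul_line_eq_zero p h4
  have h6 : lineProj p * Z.1.op = 0 := by
    have := congrArg star h5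
    rwa [star_mul, line_star, skewHS_star, star_zero, mul_neg, neg_eq_zero] at this
  apply Subtype.ext; apply HSOp.op_injective
  have h7 : p.P * Z.1.op = 0 := by
    rw [sub_mul, h6, sub_zero, mul_sub, mul_assoc, mul_assoc, h5, mul_zero, sub_zero, h3,
      ← mul_assoc, P_mul_P] at h1
    exact h1
  rw [sub_mul, one_mul, h7, sub_zero, mul_sub, h3, h7] at h2
  simpa using h2

/-- The restriction of `δ` to the horizontal space, with values in the tangent space. -/
def deltaHor : horizontalSpace p →ₗ[ℝ] tangentSpace p :=
  ((delta p).domRestrict (horizontalSpace p)).codRestrict (tangentSpace p)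
    fun Z => ⟨Z.1, rfl⟩

theorem deltaHor_bijective : Function.Bijective (deltaHor p) := by
  constructor
  · rw [injective_iff_map_eq_zero]
    intro Z hZ
    exact Subtype.ext (horizontal_inj p Z.1 Z.2 (congrArg Subtype.val hZ))
  · rintro ⟨_, W, rfl⟩
    refine ⟨⟨_, horizontal_sub p W⟩, Subtype.ext ?_⟩
    change delta p (W - _) = delta p W
    rw [map_sub, delta_vertOp, sub_zero]

/-- The horizontal lift `κ_p`, the inverse of the restriction of `δ_p` to the horizontal space. -/
def horizontalLift : tangentSpace p ≃ₗ[ℝ] horizontalSpace p :=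
  (LinearEquiv.ofBijective (deltaHor p) (deltaHor_bijective p)).symm

/-- The norm on the tangent space at `p` given by the quotient Riemannian metric:
the Hilbert-Schmidt norm of the horizontal lift. -/
def quotNorm (V : tangentSpace p) : ℝ := ‖horizontalLift p V‖

/-- Pairs `(A, g)` satisfying the linearized equations of the bundle are tangent. -/
theorem mem_tangentSpace_of (A : HSOp H) (g : H) (hA : star A.op = A.op)
    (hAP : A.op * p.P + p.P * A.op = A.op) (hf : A.op p.f + p.P g = g)
    (hg : (inner ℂ p.f g).re = 0) : (A, g) ∈ tangentSpace p := by
  have hPAP : p.P * A.op * p.P = 0 := by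
    have := congrArg (fun X => p.P * X) hAP
    simp only [mul_add, ← mul_assoc, P_mul_P, add_eq_right] at this
    exact this
  set h := p.P g with hh
  have hPh : p.P h = h := by
    have := congrArg (fun X : H →L[ℂ] H => X g) (P_mul_P p)
    simpa using this
  set c : ℂ := inner ℂ h p.f with hc
  have hcs : (starRingEnd ℂ) c = -c := by
    have e : c = inner ℂ g p.f := by
      rw [hc, hh, ← ContinuousLinearMap.adjoint_inner_right, ← ContinuousLinearMap.star_eq_adjoint,
        P_star, p.apply_eq]
    have hre : c.re = 0 := by
      rw [e, ← inner_conj_symm, Complex.conj_re, hg]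
    apply Complex.ext <;> simp [hre]
  let z : H →L[ℂ] H := InnerProductSpace.rankOne ℂ h p.f - InnerProductSpace.rankOne ℂ p.f h
    + c • lineProj p
  have hz : z ∈ hsSubmodule H := add_mem (sub_mem (rankOne_mem _ _) (rankOne_mem _ _))
    (Submodule.smul_mem _ _ (rankOne_mem _ _))
  have hzs : star z = -z := by
    simp only [z, star_add, star_sub, star_rankOne, star_smul, line_star]
    rw [show star c = -c from hcs]
    simp; abel
  have hzP : z * p.P = p.P * z := by
    simp only [z, add_mul, sub_mul, mul_add, mul_sub, rankOne_mul_P, P_mul_rankOne, hPh,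
      p.apply_eq, smul_mul_assoc, mul_smul_comm, line_mul_P, P_mul_line]
  have hzf : z p.f = h := by
    simp only [z, _root_.add_apply, _root_.sub_apply,
      _root_.smul_apply, line_apply, InnerProductSpace.rankOne_apply]
    rw [← hc, inner_self_eq_norm_sq_to_K, p.norm_eq_one]
    simp
  let Y : H →L[ℂ] H := (A.op * p.P - p.P * A.op) + z
  have hY : Y ∈ hsSubmodule H := add_mem (sub_mem (mul_mem_hs_right _ A.op_mem)
    (mul_mem_hs_left _ A.op_mem)) hz
  have hYs : HSOp.mk Y hY ∈ skewHS H := by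
    rw [mem_skewHS_iff, HSOp.op_mk]
    simp only [Y, star_add, star_sub, star_mul, hA, P_star, hzs]
    abel
  refine ⟨⟨HSOp.mk Y hY, hYs⟩, Prod.ext (HSOp.op_injective ?_) ?_⟩
  · change Y * p.P - p.P * Y = A.op
    simp only [Y, add_mul, mul_add, sub_mul, mul_sub, hzP, ← mul_assoc, hPAP, P_mul_P]
    rw [mul_assoc, P_mul_P]
    conv_rhs => rw [← hAP]
    abel
  · change Y p.f = g
    have e : p.P (A.op p.f) = 0 := by
      have := congrArg (fun X : H →L[ℂ] H => X p.f) hPAP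
      simpa [p.apply_eq] using this
    simp only [Y, _root_.add_apply, _root_.sub_apply,
      ContinuousLinearMap.mul_def, ContinuousLinearMap.comp_apply, p.apply_eq, e, hzf, sub_zero]
    exact hf

end Lift

variable (Pp) in
/-- Smooth curves `ℝ → R₂⁺`. -/
structure SmoothCurve where
  toFun : ℝ → RestrictedBundle Pp
  smooth : ContDiff ℝ ∞ fun t => (toFun t).emb

instance : CoeFun (SmoothCurve Pp) fun _ => ℝ → RestrictedBundle Pp := ⟨SmoothCurve.toFun⟩

/-- The velocity of a smooth curve in `R₂⁺` is tangent. -/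
theorem SmoothCurve.deriv_mem (γ : SmoothCurve Pp) (t : ℝ) :
    deriv (fun t => (γ t).emb) t ∈ tangentSpace (γ t) := by
  set v := deriv (fun t => (γ t).emb) t with hv
  have hd : HasDerivAt (fun t => (γ t).emb) v t :=
    ((γ.smooth.differentiable (by simp)) t).hasDerivAt
  have hf : HasDerivAt (fun t => (γ t).f) v.2 t := hd.snd
  have h1 : HasDerivAt (fun t => (γ t).P - Pp) v.1.op t :=
    (HSOp.opL.restrictScalars ℝ).hasFDerivAt.comp_hasDerivAt t hd.fst
  have hP : HasDerivAt (fun t => (γ t).P) v.1.op t := by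
    simpa using h1.add_const Pp
  refine mem_tangentSpace_of (γ t) v.1 v.2 ?_ ?_ ?_ ?_
  · have h2 : HasDerivAt (fun t => star (γ t).P) (star v.1.op) t := hP.star
    simp only [P_star] at h2
    exact h2.unique hP
  · have h2 := hP.mul hP
    have e : ((fun t => (γ t).P) * fun t => (γ t).P) = fun t => (γ t).P :=
      funext fun t => P_mul_P (γ t)
    rw [e] at h2
    exact h2.unique hP
  · have h2 := ((ContinuousLinearMap.restrictScalarsL ℂ H H ℝ ℝ).hasFDerivAt.comp_hasDerivAt t
      hP).clm_apply hf
    have e : (fun t => (γ t).P (γ t).f) = fun t => (γ t).f := funext fun t => (γ t).apply_eq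
    have h3 : HasDerivAt (fun t => (γ t).P (γ t).f) (v.1.op (γ t).f + (γ t).P v.2) t := h2
    rw [e] at h3
    exact h3.unique hf
  · have h2 := (hf.inner ℂ hf)
    have e : (fun t => inner ℂ (γ t).f (γ t).f) = fun _ : ℝ => (1 : ℂ) := funext fun t => by
      rw [inner_self_eq_norm_sq_to_K, (γ t).norm_eq_one]; simp
    rw [e] at h2
    have h3 := congrArg Complex.re (h2.unique (hasDerivAt_const t (1 : ℂ)))
    rw [← inner_conj_symm v.2] at h3
    simp only [Complex.add_re, Complex.conj_re, Complex.zero_re] at h3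
    linarith

/-- The velocity vector of a smooth curve. -/
def SmoothCurve.velocity (γ : SmoothCurve Pp) (t : ℝ) : tangentSpace (γ t) :=
  ⟨deriv (fun t => (γ t).emb) t, γ.deriv_mem t⟩

/-- The energy of a curve on `[a, b]` in the quotient metric. -/
def SmoothCurve.energy (γ : SmoothCurve Pp) (a b : ℝ) : ℝ :=
  1 / 2 * ∫ t in a..b, quotNorm (γ t) (γ.velocity t) ^ 2

/-- `Γ` is a smooth variation of `γ` with fixed end points on `[a, b]`. -/
structure IsVariation (γ : SmoothCurve Pp) (a b : ℝ) (Γ : ℝ → SmoothCurve Pp) : Prop where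
  smooth : ContDiff ℝ ∞ fun q : ℝ × ℝ => (Γ q.1 q.2).emb
  zero : Γ 0 = γ
  left : ∀ s, Γ s a = γ a
  right : ∀ s, Γ s b = γ b

/-- Geodesics of the quotient metric: smooth curves that on every compact interval are critical
points of the energy with respect to smooth variations with fixed end points. -/
def IsGeodesic (γ : SmoothCurve Pp) : Prop :=
  ∀ a b : ℝ, a < b → ∀ Γ : ℝ → SmoothCurve Pp, IsVariation γ a b Γ →
    HasDerivAt (fun s => (Γ s).energy a b) 0 0

/-- `γ` is a geodesic starting at `p` with initial velocity `V`. -/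
def IsGeodesicFrom (p : RestrictedBundle Pp) (V : tangentSpace p) (γ : SmoothCurve Pp) : Prop :=
  IsGeodesic γ ∧ γ 0 = p ∧ (γ.velocity 0 : HSOp H × H) = V

open Classical in
/-- The Riemannian exponential of the quotient metric: the value at time `1` of the geodesic that
starts at `p` with velocity `V` (the default value `p` is irrelevant: such geodesics exist). -/
def riemExp (p : RestrictedBundle Pp) (V : tangentSpace p) : RestrictedBundle Pp :=
  if h : ∃ γ, IsGeodesicFrom p V γ then h.choose 1 else p

end Bundle
end SphereBundle

end

open scoped ContDiff ENNReal InnerProductSpace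

noncomputable section

namespace SphereBundle

/-! ### Index zero for approximable perturbations of the identity -/

section Index

/-! Everything is driven by the action of the operators `exp Z`, `Z` anti-Hermitian and
Hilbert-Schmidt, on pairs `(P, f)`. A projection need not be Hilbert-Schmidt, so `P` is written as
`T + c Pp` and stored in the triple `(T, f, c)`. On triples the action is linear, and its
infinitesimal form is a representation of the Lie algebra by bounded operators
(`infAct_commutator`). It preserves the bundle because `exp Z - 1` is Hilbert-Schmidt: the
displacement stays in `B₂`, and the index is unchanged (`projIndex_conj`, by a Fredholm argument
with finite rank approximation).

Geodesics. Let `z` be the horizontal lift of the velocity of a curve and `W` any lift of a variation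
field. Equality of mixed partial derivatives shows that `∂ₛz - W' + [z, W]` is vertical, hence
orthogonal to `z`; moreover `⟪z, [z, W]⟫ = 0` because `ad z` is skew and kills `z`. So the first
variation of the energy is `∫ ⟪z, W'⟫` (`IsVariation.hasDerivAt_energy`). A constant `z` is
therefore critical, and conversely the choices `W = φ X` and the du Bois-Reymond lemma force `z` to
be constant. A curve with constant lift `Z` solves the autonomous linear equation `x' = Z • x`, so
it is `exp (t Z) • p`; that curve does have lift `Z`, since conjugation by `exp (t Z)` carries the
block conditions on `Z` from `p` to the moved point.

Differential. With `q = exp Z • p`, the derivative of the matrix exponential gives `W ↦ δ_q (e^(ad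
Z) F(ad Z) W)` on horizontal `W` (`hasFDerivAt_expMove`). Translation by `exp Z` matches the kernels
of `δ_p` and `δ_q`, so it remains to see that `δ_p ∘ F(ad Z)` is bijective from the horizontal space
to `T_p`. As the kernel of `δ_p` is the orthogonal complement of the horizontal space, this says
that the compression of `F(ad Z)` to the horizontal space is invertible, which follows from `‖F(ad
Z) - 1‖ < 1` by a Neumann series.

Norm estimate. On the complex space `B₂`, `ad Z` is skew-adjoint of norm at most `2‖Z‖`, so the
functional calculus reduces the bound to points `iθ` with `|θ| ≤ 2‖Z‖`. There `|F(iθ) - 1| < 1`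
amounts, for `θ ≠ 0`, to `θ sin θ + cos θ - 1 > 0`, which holds for `0 < |θ| < r₀`; hence the
threshold `r₀ / 2`. -/

/-- Kernel and cokernel of `id + N` agree with those of its restriction to the range of `N`, an
endomorphism of a finite-dimensional space, whose index vanishes. -/
theorem finite_index_id_add {K V : Type*} [Field K] [AddCommGroup V] [Module K V]
    (N : V →ₗ[K] V) [FiniteDimensional K N.range] :
    FiniteDimensional K (LinearMap.id + N).ker ∧
      FiniteDimensional K (V ⧸ (LinearMap.id + N).range) ∧ (LinearMap.id + N).index = 0 := by
  set T : V →ₗ[K] V := LinearMap.id + N with hT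
  have hTx : ∀ x, T x = x + N x := fun x => rfl
  have hmaps : ∀ x ∈ N.range, T x ∈ N.range := fun x hx =>
    add_mem hx ⟨x, rfl⟩
  let g : N.range →ₗ[K] N.range := T.restrict hmaps
  have hg : ∀ x : N.range, (g x : V) = T x := fun x => rfl
  have hker : ∀ x ∈ T.ker, x ∈ N.range := fun x hx => by
    have h : x + N x = 0 := hx
    exact ⟨-x, by rw [map_neg, neg_eq_iff_add_eq_zero, add_comm]; exact h⟩
  let e₁ : g.ker ≃ₗ[K] T.ker := LinearEquiv.ofBijective
    ((N.range.subtype.domRestrict g.ker).codRestrict T.ker fun x => by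
      have := congrArg Subtype.val x.2; exact this) <| by
    constructor
    · intro x y h
      exact Subtype.ext (Subtype.ext (congrArg (fun z : T.ker => (z : V)) h))
    · intro x
      exact ⟨⟨⟨x.1, hker _ x.2⟩, Subtype.ext x.2⟩, rfl⟩
  have hle : g.range ≤ T.range.comap N.range.subtype := by
    rintro _ ⟨x, rfl⟩
    exact ⟨x, rfl⟩
  let e₂ : (N.range ⧸ g.range) ≃ₗ[K] (V ⧸ T.range) := LinearEquiv.ofBijective
    (g.range.mapQ T.range N.range.subtype hle) <| by
    constructor
    · rw [← LinearMap.ker_eq_bot, Submodule.ker_mapQ, eq_bot_iff, Submodule.map_le_iff_le_comap]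
      rintro y ⟨x, hx⟩
      have hx' : x ∈ N.range := by
        have : x = y - N x := by rw [← show T x = y from hx, hTx]; abel
        rw [this]; exact sub_mem y.2 ⟨x, rfl⟩
      change g.range.mkQ y = 0
      rw [Submodule.mkQ_apply, Submodule.Quotient.mk_eq_zero]
      exact ⟨⟨x, hx'⟩, Subtype.ext hx⟩
    · intro y
      obtain ⟨y, rfl⟩ := Submodule.Quotient.mk_surjective _ y
      refine ⟨Submodule.Quotient.mk ⟨N (-y), ⟨_, rfl⟩⟩, ?_⟩
      rw [Submodule.mapQ_apply, Submodule.Quotient.eq]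
      exact ⟨-y, by simp only [hTx, Submodule.subtype_apply]; abel⟩
  refine ⟨e₁.finiteDimensional, e₂.finiteDimensional, ?_⟩
  rw [LinearMap.index_eq_finrank_sub, ← e₁.finrank_eq, ← e₂.finrank_eq,
    ← LinearMap.index_eq_finrank_sub, LinearMap.index_eq_of_finiteDimensional, sub_self]

variable {X Y W : Type*} [NormedAddCommGroup X] [NormedSpace ℂ X] [NormedAddCommGroup Y]
  [NormedSpace ℂ Y] [NormedAddCommGroup W] [NormedSpace ℂ W]

/-- Norm limits of bounded operators of finite rank. -/
def IsApproximable (T : X →L[ℂ] Y) : Prop :=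
  ∀ ε : ℝ, 0 < ε → ∃ N : X →L[ℂ] Y, FiniteDimensional ℂ N.toLinearMap.range ∧ ‖T - N‖ < ε

theorem IsApproximable.comp_left {T : X →L[ℂ] Y} (hT : IsApproximable T) (A : Y →L[ℂ] W) :
    IsApproximable (A ∘L T) := by
  intro ε hε
  obtain ⟨N, hN, h⟩ := hT (ε / (‖A‖ + 1)) (by positivity)
  refine ⟨A ∘L N, ?_, ?_⟩
  · rw [ContinuousLinearMap.toLinearMap_comp, LinearMap.range_comp]
    infer_instance
  · rw [← ContinuousLinearMap.comp_sub]
    refine (ContinuousLinearMap.opNorm_comp_le _ _).trans_lt ?_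
    rw [lt_div_iff₀ (by positivity)] at h
    nlinarith [norm_nonneg A, norm_nonneg (T - N)]

theorem IsApproximable.comp_right {T : X →L[ℂ] Y} (hT : IsApproximable T) (A : W →L[ℂ] X) :
    IsApproximable (T ∘L A) := by
  intro ε hε
  obtain ⟨N, hN, h⟩ := hT (ε / (‖A‖ + 1)) (by positivity)
  refine ⟨N ∘L A, ?_, ?_⟩
  · exact Submodule.finiteDimensional_of_le (LinearMap.range_comp_le_range A.toLinearMap
      N.toLinearMap)
  · rw [← ContinuousLinearMap.sub_comp]
    refine (ContinuousLinearMap.opNorm_comp_le _ _).trans_lt ?_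
    rw [lt_div_iff₀ (by positivity)] at h
    nlinarith [norm_nonneg A, norm_nonneg (T - N)]

/-- If `‖C - N‖ < 1` with `N` of finite rank, then `e = 1 + (C - N)` is invertible and `id + C = e ∘
(id + e⁻¹ N)`, which reduces to the finite rank case. -/
theorem IsApproximable.finite_index_id_add [CompleteSpace X] {C : X →L[ℂ] X}
    (hC : IsApproximable C) :
    FiniteDimensional ℂ (LinearMap.id + C.toLinearMap).ker ∧
      FiniteDimensional ℂ (X ⧸ (LinearMap.id + C.toLinearMap).range) ∧
      (LinearMap.id + C.toLinearMap).index = 0 := by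
  obtain ⟨N, hN, h⟩ := hC 1 one_pos
  let u : (X →L[ℂ] X)ˣ := Units.oneSub (-(C - N)) (by rwa [norm_neg])
  let e : X ≃L[ℂ] X := ContinuousLinearEquiv.unitsEquiv ℂ X u
  have he : ∀ x, e x = x + (C x - N x) := fun x => by
    change (1 - -(C - N)) x = _
    rw [sub_neg_eq_add]
    rfl
  let M : X →ₗ[ℂ] X := e.symm.toLinearEquiv.toLinearMap ∘ₗ N.toLinearMap
  have hM : FiniteDimensional ℂ M.range := by
    rw [LinearMap.range_comp]; infer_instance
  have hfac : LinearMap.id + C.toLinearMap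
      = e.toLinearEquiv.toLinearMap ∘ₗ (LinearMap.id + M) := by
    ext x
    have : e (x + e.symm (N x)) = x + C x := by
      rw [map_add, e.apply_symm_apply, he]; abel
    exact this.symm
  obtain ⟨h1, h2, h3⟩ := SphereBundle.finite_index_id_add M
  have k1 : FiniteDimensional ℂ e.toLinearEquiv.toLinearMap.ker := by
    rw [LinearEquiv.ker]; infer_instance
  have k2 : FiniteDimensional ℂ (X ⧸ e.toLinearEquiv.toLinearMap.range) := by
    rw [LinearEquiv.range]; infer_instance
  rw [hfac]
  refine ⟨?_, ?_, ?_⟩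
  · rw [LinearEquiv.ker_comp]; exact h1
  · rw [LinearMap.range_comp]; infer_instance
  · rw [LinearMap.index_comp, h3, LinearEquiv.index_eq_zero, add_zero]

/-- `R` is a parametrix of `T`: both composites have finite-dimensional kernel and cokernel, so `T`
and `R` do too, and additivity of the index applies to `R ∘ T`. -/
theorem index_add_index_eq_zero [CompleteSpace X] [CompleteSpace Y] (T : X →ₗ[ℂ] Y) (R : Y →ₗ[ℂ] X)
    {C : X →L[ℂ] X} {D : Y →L[ℂ] Y} (hC : IsApproximable C) (hD : IsApproximable D)
    (hRT : R ∘ₗ T = LinearMap.id + C.toLinearMap) (hTR : T ∘ₗ R = LinearMap.id + D.toLinearMap) :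
    R.index + T.index = 0 ∧ FiniteDimensional ℂ T.ker ∧ FiniteDimensional ℂ (Y ⧸ T.range) := by
  obtain ⟨c1, c2, c3⟩ := hC.finite_index_id_add
  obtain ⟨d1, d2, -⟩ := hD.finite_index_id_add
  rw [← hRT] at c1 c2 c3
  rw [← hTR] at d1 d2
  have t1 : FiniteDimensional ℂ T.ker :=
    Submodule.finiteDimensional_of_le (LinearMap.ker_le_ker_comp T R)
  have r1 : FiniteDimensional ℂ R.ker :=
    Submodule.finiteDimensional_of_le (LinearMap.ker_le_ker_comp R T)
  have t2 : FiniteDimensional ℂ (Y ⧸ T.range) :=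
    Module.Finite.of_surjective _ (Submodule.factor_surjective (LinearMap.range_comp_le_range R T))
  have r2 : FiniteDimensional ℂ (X ⧸ R.range) :=
    Module.Finite.of_surjective _ (Submodule.factor_surjective (LinearMap.range_comp_le_range T R))
  exact ⟨by rw [← LinearMap.index_comp, c3], t1, t2⟩

end Index

/-! ### Invariance of the index of a pair of projections -/

section Projections

variable {H : Type*} [NormedAddCommGroup H] [InnerProductSpace ℂ H] [CompleteSpace H]

/-- Truncation of `T` to finitely many basis vectors leaves an error whose Hilbert-Schmidt norm is a
tail of the convergent sum, and this norm dominates the operator norm. -/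
theorem isApproximable_of_mem_hsSubmodule {T : H →L[ℂ] H} (hT : T ∈ hsSubmodule H) :
    IsApproximable T := by
  classical
  intro ε hε
  have hsum : hsSum T ≠ ⊤ := (mem_hsSubmodule_iff T).1 hT
  have ht := ENNReal.tendsto_tsum_compl_atTop_zero hsum
  have hε' : (0 : ℝ≥0∞) < ENNReal.ofReal ε ^ 2 := by positivity
  obtain ⟨s, hs⟩ := (ht.eventually (gt_mem_nhds hε')).exists
  let N : H →L[ℂ] H := ∑ i ∈ s, InnerProductSpace.rankOne ℂ (T (basis H i)) (basis H i)
  have hNe : ∀ j, N (basis H j) = if j ∈ s then T (basis H j) else 0 := fun j => by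
    have h : ∀ i, InnerProductSpace.rankOne ℂ (T (basis H i)) (basis H i) (basis H j)
        = if i = j then T (basis H i) else 0 := fun i => by
      rw [InnerProductSpace.rankOne_apply, orthonormal_iff_ite.1 (basis H).orthonormal i j]
      split_ifs <;> simp
    simp only [N, _root_.sum_apply, h]
    rw [Finset.sum_ite_eq' s j]
  have hNm : N ∈ hsSubmodule H := Submodule.sum_mem _ fun i _ => rankOne_mem _ _
  refine ⟨N, ?_, ?_⟩
  · have hle : N.toLinearMap.range ≤ Submodule.span ℂ ((s.image fun i => T (basis H i) : Finset H) : Set H) := by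
      rintro _ ⟨x, rfl⟩
      change N x ∈ _
      simp only [N, _root_.sum_apply, InnerProductSpace.rankOne_apply]
      exact Submodule.sum_mem _ fun i hi => Submodule.smul_mem _ _
        (Submodule.subset_span (Finset.mem_coe.2 (Finset.mem_image_of_mem _ hi)))
    have : FiniteDimensional ℂ
        (Submodule.span ℂ ((s.image fun i => T (basis H i) : Finset H) : Set H)) :=
      FiniteDimensional.span_finset ℂ _
    exact Submodule.finiteDimensional_of_le hle
  · have hle := HSOp.opNorm_le (HSOp.mk (T - N) (sub_mem hT hNm))
    refine hle.trans_lt ?_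
    have h2 : ‖HSOp.mk (T - N) (sub_mem hT hNm)‖ₑ ^ 2 < ENNReal.ofReal ε ^ 2 := by
      rw [HSOp.enorm_sq]
      refine lt_of_le_of_lt ?_ hs
      have h3 := tsum_subtype ((s : Set (basisIndex H))ᶜ) (fun i => ‖T (basis H i)‖ₑ ^ 2)
      refine le_of_eq (Eq.trans ?_ h3.symm)
      refine tsum_congr fun j => ?_
      simp only [HSOp.op_mk, Set.indicator_apply]
      by_cases hj : j ∈ s <;> simp [hj, hNe]
    rw [ENNReal.pow_lt_pow_left_iff two_ne_zero, ← ofReal_norm,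
      ENNReal.ofReal_lt_ofReal_iff hε] at h2
    exact h2

/-- Up to the bijection `U : R(P) → R(UPV)`, the new pair map is `PV` on `R(Pp)`. It has the same
parametrix `Pp : R(P) → R(Pp)` as the original pair map, so both have the same index. -/
theorem projIndex_conj {Pp P U V : H →L[ℂ] H} (hPp : IsStarProjection Pp) (hP : IsStarProjection P)
    (hsub : P - Pp ∈ hsSubmodule H) (hVU : V * U = 1) (hV : V - 1 ∈ hsSubmodule H)
    (hidx : projIndex Pp P = 0) : projIndex Pp (U * P * V) = 0 := by
  have hPP : ∀ x, P (P x) = P x := fun x => congrArg (fun A => A x) hP.isIdempotentElem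
  have hQQ : ∀ x, Pp (Pp x) = Pp x := fun x => congrArg (fun A => A x) hPp.isIdempotentElem
  have hPr : ∀ x : P.range, P x = x := by rintro ⟨_, x, rfl⟩; exact hPP x
  have hQr : ∀ x : Pp.range, Pp x = x := by rintro ⟨_, x, rfl⟩; exact hQQ x
  have hVUx : ∀ x, V (U x) = x := fun x => congrArg (fun A => A x) hVU
  have : CompleteSpace P.range :=
    (ContinuousLinearMap.IsIdempotentElem.isClosed_range hP.isIdempotentElem).completeSpace_coe
  have : CompleteSpace Pp.range :=
    (ContinuousLinearMap.IsIdempotentElem.isClosed_range hPp.isIdempotentElem).completeSpace_coe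
  let C : (H →L[ℂ] H) → Pp.range →L[ℂ] Pp.range := fun S =>
    (Pp.rangeRestrict ∘L S) ∘L Pp.range.subtypeL
  let D : (H →L[ℂ] H) → P.range →L[ℂ] P.range := fun S =>
    (P.rangeRestrict ∘L S) ∘L P.range.subtypeL
  have hC : ∀ S ∈ hsSubmodule H, IsApproximable (C S) := fun S hS =>
    ((isApproximable_of_mem_hsSubmodule hS).comp_left _).comp_right _
  have hD : ∀ S ∈ hsSubmodule H, IsApproximable (D S) := fun S hS =>
    ((isApproximable_of_mem_hsSubmodule hS).comp_left _).comp_right _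
  have hsub' : Pp - P ∈ hsSubmodule H := by rw [← neg_sub]; exact neg_mem hsub
  -- These operators, compressed to the two ranges, are the defects of the parametrix for `PV`.
  have h1 : P * (V - 1) + (P - Pp) ∈ hsSubmodule H := add_mem (mul_mem_hs_left _ hV) hsub
  have h2 : (V - 1) * Pp + (Pp - P) ∈ hsSubmodule H := add_mem (mul_mem_hs_right _ hV) hsub'
  let T : Pp.range →ₗ[ℂ] P.range :=
    ((P ∘L V).toLinearMap.domRestrict Pp.range).codRestrict P.range fun x => ⟨V x, rfl⟩
  have e1 := index_add_index_eq_zero (pairMap Pp P) (pairMap P Pp) (hC _ hsub) (hD _ hsub')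
    (by
      ext x
      change Pp (P (P (Pp x))) = x + Pp (P x - Pp x)
      rw [hPP, map_sub, hQr, hQr]; abel)
    (by
      ext x
      change P (Pp (Pp (P x))) = x + P (Pp x - P x)
      rw [hQQ, map_sub, hPr, hPr]; abel)
  obtain ⟨e2, k1, k2⟩ := index_add_index_eq_zero T (pairMap P Pp) (hC _ h1) (hD _ h2)
    (by
      ext x
      change Pp (P (P (V x))) = x + Pp (P (V x - x) + (P x - Pp x))
      simp only [hPP, map_sub, map_add, hQr]; abel)
    (by
      ext x
      change P (V (Pp (P x))) = x + P ((V (Pp x) - Pp x) + (Pp x - P x))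
      simp only [map_sub, map_add, hPr]; abel)
  have hmem : ∀ x : P.range, U x ∈ (U * P * V).range := fun x => ⟨U x, by
    change U (P (V (U x))) = U x
    rw [hVUx, hPr]⟩
  let e : P.range ≃ₗ[ℂ] (U * P * V).range := LinearEquiv.ofBijective
    ((U.toLinearMap.domRestrict P.range).codRestrict _ hmem) <| by
    constructor
    · intro x y h
      have h' : U x = U y := congrArg (fun z : (U * P * V).range => (z : H)) h
      exact Subtype.ext (by rw [← hVUx x, h', hVUx])
    · rintro ⟨_, x, rfl⟩
      exact ⟨⟨P (V x), V x, rfl⟩, rfl⟩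
  have hfac : pairMap Pp (U * P * V) = e.toLinearMap ∘ₗ T := by
    ext x
    change U (P (V (Pp x))) = U (P (V x))
    rw [hQr]
  have q1 : FiniteDimensional ℂ e.toLinearMap.ker := by rw [LinearEquiv.ker]; infer_instance
  have q2 : FiniteDimensional ℂ (_ ⧸ e.toLinearMap.range) := by
    rw [LinearEquiv.range]; infer_instance
  change (pairMap Pp P).index = 0 at hidx
  change (pairMap Pp (U * P * V)).index = 0
  rw [hfac, LinearMap.index_comp, LinearEquiv.index_eq_zero]
  have e3 := e1.1
  rw [hidx, add_zero] at e3
  rw [e3, zero_add] at e2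
  rw [e2, add_zero]

end Projections

/-! ### Multiplications, adjoints and the adjoint representation on `B₂` -/

section HSAlgebra

variable {H : Type*} [NormedAddCommGroup H] [InnerProductSpace ℂ H] [CompleteSpace H]

@[ext] theorem HSOp.ext {S T : HSOp H} (h : S.op = T.op) : S = T := HSOp.op_injective h

/-- Left multiplication of Hilbert-Schmidt operators by bounded operators. -/
def lmulHS : (H →L[ℂ] H) →L[ℂ] HSOp H →L[ℂ] HSOp H :=
  LinearMap.mkContinuous₂ (LinearMap.mk₂ ℂ
    (fun (A : H →L[ℂ] H) (T : HSOp H) => HSOp.mk (A * T.op) (mul_mem_hs_left A T.op_mem))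
    (fun A B T => by ext1; simp [add_mul])
    (fun c A T => by ext1; simp)
    (fun A S T => by ext1; simp [mul_add])
    (fun c A T => by ext1; simp)) 1
    fun A T => by rw [one_mul]; exact HSOp.norm_mk_mul_le A T

/-- Right multiplication of Hilbert-Schmidt operators by bounded operators. -/
def rmulHS : (H →L[ℂ] H) →L[ℂ] HSOp H →L[ℂ] HSOp H :=
  LinearMap.mkContinuous₂ (LinearMap.mk₂ ℂ
    (fun (A : H →L[ℂ] H) (T : HSOp H) => HSOp.mk (T.op * A) (mul_mem_hs_right A T.op_mem))
    (fun A B T => by ext1; simp [mul_add])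
    (fun c A T => by ext1; simp)
    (fun A S T => by ext1; simp [add_mul])
    (fun c A T => by ext1; simp)) 1
    fun A T => by rw [one_mul]; exact HSOp.norm_mk_mul_le' T A

@[simp] theorem lmulHS_op (A : H →L[ℂ] H) (T : HSOp H) : (lmulHS A T).op = A * T.op := rfl
@[simp] theorem rmulHS_op (A : H →L[ℂ] H) (T : HSOp H) : (rmulHS A T).op = T.op * A := rfl

theorem norm_lmulHS_le (A : H →L[ℂ] H) : ‖lmulHS A‖ ≤ ‖A‖ :=
  ContinuousLinearMap.opNorm_le_bound _ (norm_nonneg _) (HSOp.norm_mk_mul_le A)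

theorem norm_rmulHS_le (A : H →L[ℂ] H) : ‖rmulHS A‖ ≤ ‖A‖ :=
  ContinuousLinearMap.opNorm_le_bound _ (norm_nonneg _) fun T => HSOp.norm_mk_mul_le' T A

/-- The rank one operators `x ⊗ y = ⟪y, ·⟫ x` as a bounded real bilinear map. -/
def rankOneHS : H →L[ℝ] H →L[ℝ] HSOp H :=
  LinearMap.mkContinuous₂ (LinearMap.mk₂ ℝ
    (fun x y : H => HSOp.mk (InnerProductSpace.rankOne ℂ x y) (rankOne_mem x y))
    (fun x y z => by ext1; simp)
    (fun c x y => by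
      ext1; ext z
      simp only [op_smul_real, HSOp.op_mk, _root_.smul_apply, InnerProductSpace.rankOne_apply]
      rw [smul_comm])
    (fun x y z => by ext1; simp)
    (fun c x y => by
      ext1; ext z
      simp [InnerProductSpace.rankOne_apply, ← Complex.coe_smul])) 1
    fun x y => by
      refine norm_le_of_enorm_sq_le (by positivity) ?_
      rw [HSOp.enorm_sq, one_mul, ofReal_norm, enorm_sq_eq_tsum y, ← ENNReal.tsum_mul_left]
      refine le_of_eq (tsum_congr fun i => ?_)
      simp only [LinearMap.mk₂_apply, HSOp.op_mk, InnerProductSpace.rankOne_apply]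
      rw [enorm_smul, mul_pow, ← inner_conj_symm, ← ofReal_norm (starRingEnd ℂ _),
        RCLike.norm_conj, ofReal_norm, mul_comm]

@[simp] theorem rankOneHS_op (x y : H) : (rankOneHS x y).op = InnerProductSpace.rankOne ℂ x y := rfl

theorem star_mem_hsSubmodule {T : H →L[ℂ] H} (hT : T ∈ hsSubmodule H) :
    star T ∈ hsSubmodule H := by
  rw [mem_hsSubmodule_iff, hsSum_star]
  exact (mem_hsSubmodule_iff T).1 hT

/-- The adjoint of a Hilbert-Schmidt operator. -/
def HSOp.adj (T : HSOp H) : HSOp H := HSOp.mk (star T.op) (star_mem_hsSubmodule T.op_mem)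

@[simp] theorem HSOp.adj_op (T : HSOp H) : T.adj.op = star T.op := rfl

theorem HSOp.norm_adj (T : HSOp H) : ‖T.adj‖ = ‖T‖ := by
  have h : ‖T.adj‖ₑ ^ 2 = ‖T‖ₑ ^ 2 := by
    rw [HSOp.enorm_sq, HSOp.enorm_sq, HSOp.adj_op, hsSum_star]
  rw [← toReal_enorm, ← toReal_enorm, (ENNReal.pow_right_strictMono two_ne_zero).injective h]

theorem HSOp.inner_eq_re (S T : HSOp H) : inner ℝ S T = (inner ℂ S T).re := rfl

theorem HSOp.adj_add (S T : HSOp H) : (S + T).adj = S.adj + T.adj := by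
  ext1; simp

/-- Polarization of `norm_adj`. The adjoint is conjugate-linear, so it is only the real part of the
trace form that is preserved. -/
theorem HSOp.real_inner_adj (S T : HSOp H) : inner ℝ S.adj T.adj = inner ℝ S T := by
  rw [real_inner_eq_norm_add_mul_self_sub_norm_mul_self_sub_norm_mul_self_div_two,
    real_inner_eq_norm_add_mul_self_sub_norm_mul_self_sub_norm_mul_self_div_two, ← HSOp.adj_add]
  simp only [HSOp.norm_adj]

theorem HSOp.hasSum_inner (S T : HSOp H) :
    HasSum (fun i => inner ℂ (S.op (basis H i)) (T.op (basis H i))) (inner ℂ S T) :=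
  lp.hasSum_inner (HSOp.toLp S) (HSOp.toLp T)

theorem HSOp.inner_lmul (A : H →L[ℂ] H) (S T : HSOp H) :
    inner ℂ (lmulHS A S) T = inner ℂ S (lmulHS (star A) T) := by
  refine (HSOp.hasSum_inner _ _).unique ?_
  convert HSOp.hasSum_inner S (lmulHS (star A) T) using 2 with i
  simp only [lmulHS_op, mul_apply_eq_comp, ContinuousLinearMap.star_eq_adjoint]
  rw [ContinuousLinearMap.adjoint_inner_right]

theorem HSOp.real_inner_lmul (A : H →L[ℂ] H) (S T : HSOp H) :
    inner ℝ (lmulHS A S) T = inner ℝ S (lmulHS (star A) T) :=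
  congrArg Complex.re (HSOp.inner_lmul A S T)

/-- Taking adjoints exchanges right and left multiplication. -/
theorem HSOp.real_inner_rmul (A : H →L[ℂ] H) (S T : HSOp H) :
    inner ℝ (rmulHS A S) T = inner ℝ S (rmulHS (star A) T) := by
  have h : ∀ (B : H →L[ℂ] H) (R : HSOp H), (rmulHS B R).adj = lmulHS (star B) R.adj := fun B R => by
    ext1; simp
  rw [← HSOp.real_inner_adj, h, HSOp.real_inner_lmul, ← h, HSOp.real_inner_adj]

theorem HSOp.inner_rmul (A : H →L[ℂ] H) (S T : HSOp H) :
    inner ℂ (rmulHS A S) T = inner ℂ S (rmulHS (star A) T) := by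
  apply Complex.ext
  · exact HSOp.real_inner_rmul A S T
  -- Imaginary parts are real parts after multiplying `S` by `i`.
  · have h := HSOp.real_inner_rmul A (Complex.I • S) T
    rw [map_smul, HSOp.inner_eq_re, HSOp.inner_eq_re, inner_smul_left, inner_smul_left] at h
    simpa using h

/-- `ad Z (W) = Z W - W Z` on all of `B₂(H)`. -/
def adHS (Z : HSOp H) : HSOp H →L[ℂ] HSOp H := lmulHS Z.op - rmulHS Z.op

@[simp] theorem adHS_op (Z W : HSOp H) : (adHS Z W).op = Z.op * W.op - W.op * Z.op := by
  simp [adHS]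

theorem norm_adHS_le (Z : HSOp H) : ‖adHS Z‖ ≤ 2 * ‖Z.op‖ := by
  refine (norm_sub_le _ _).trans ?_
  linarith [norm_lmulHS_le Z.op, norm_rmulHS_le Z.op]

/-- Skew-adjointness on the complex space `B₂` makes the complex continuous functional calculus
available; the anti-Hermitian operators form only a real space. -/
theorem star_adHS (Z : skewHS H) : star (adHS Z.1) = -adHS Z.1 := by
  rw [ContinuousLinearMap.star_eq_adjoint, eq_comm, ContinuousLinearMap.eq_adjoint_iff]
  intro S T
  simp only [adHS, _root_.neg_apply, _root_.sub_apply, inner_neg_left, inner_sub_left,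
    inner_sub_right, HSOp.inner_lmul, HSOp.inner_rmul, skewHS_star, map_neg, inner_neg_right]
  ring

theorem coe_ad (Z W : skewHS H) : (ad Z W).1 = adHS Z.1 W.1 := by
  ext1; rw [adHS_op]; rfl

theorem real_inner_ad (Z V W : skewHS H) : inner ℝ (ad Z V) W = -inner ℝ V (ad Z W) := by
  rw [Submodule.coe_inner, Submodule.coe_inner, coe_ad, coe_ad]
  simp only [adHS, _root_.sub_apply, inner_sub_left, inner_sub_right, HSOp.real_inner_lmul,
    HSOp.real_inner_rmul, skewHS_star, map_neg, _root_.neg_apply, inner_neg_right]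
  ring

theorem star_ad (Z : skewHS H) : star (ad Z) = -ad Z := by
  rw [ContinuousLinearMap.star_eq_adjoint, eq_comm, ContinuousLinearMap.eq_adjoint_iff]
  intro V W
  rw [_root_.neg_apply, inner_neg_left, real_inner_ad, neg_neg]

theorem ad_self (Z : skewHS H) : ad Z Z = 0 := by
  apply Subtype.ext; ext1; rw [coe_ad, adHS_op, sub_self]; rfl

/-- Skewness of `ad Z` together with `[Z, Z] = 0`. This removes the bracket term from the first
variation. -/
theorem real_inner_self_ad (Z W : skewHS H) : inner ℝ Z (ad Z W) = 0 := by
  have h := real_inner_ad Z Z W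
  rw [ad_self, inner_zero_left] at h
  linarith

variable {Pp : H →L[ℂ] H} (p : RestrictedBundle Pp)

/-- A vertical `Y` commutes with `P` and kills `f`, so it equals the sum of its second and third
diagonal blocks. Compression to these blocks is self-adjoint and kills a horizontal `Z`. -/
theorem real_inner_eq_zero_of_horizontal {Z Y : skewHS H} (hZ : Z ∈ horizontalSpace p)
    (hY : delta p Y = 0) : inner ℝ Z Y = 0 := by
  obtain ⟨h1, h2⟩ := hZ
  obtain ⟨h3, h4⟩ := (delta_eq_zero_iff p Y).1 hY
  have h5 := mul_line_eq_zero p h4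
  have h6 : lineProj p * Y.1.op = 0 := by
    have := congrArg star h5
    rwa [star_mul, line_star, skewHS_star, star_zero, mul_neg, neg_eq_zero] at this
  set M := p.P - lineProj p with hM
  set N := 1 - p.P with hN
  have hMs : star M = M := by rw [hM, star_sub, P_star, line_star]
  have hNs : star N = N := by rw [hN, star_sub, P_star, star_one]
  have hdec : Y.1 = lmulHS M (rmulHS M Y.1) + lmulHS N (rmulHS N Y.1) := by
    ext1
    simp only [map_add, lmulHS_op, rmulHS_op, hM, hN, mul_sub, sub_mul, h3, h5, mul_one,
      one_mul, ← mul_assoc, P_mul_P, sub_zero]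
    rw [line_mul_P, h6]
    abel
  have hz : ∀ B : H →L[ℂ] H, star B = B → B * Z.1.op * B = 0 →
      inner ℝ Z.1 (lmulHS B (rmulHS B Y.1)) = 0 := fun B hB h => by
    have e1 := HSOp.real_inner_lmul B Z.1 (rmulHS B Y.1)
    have e2 := HSOp.real_inner_rmul B (lmulHS B Z.1) Y.1
    rw [hB] at e1 e2
    rw [← e1, ← e2]
    have : rmulHS B (lmulHS B Z.1) = 0 := by ext1; simpa using h
    rw [this, inner_zero_left]
  rw [Submodule.coe_inner, hdec, inner_add_right, hz M hMs h1, hz N hNs h2, add_zero]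

end HSAlgebra

/-! ### The function `F(z) = (1 - e^(-z)) / z` and the number `r₀` -/

section EntireFunction

/-- The Taylor coefficients of `(1 - e^(-z)) / z`. -/
def quotCoeff (n : ℕ) : ℝ := (-1 : ℝ) ^ n / ((n + 1).factorial : ℝ)

variable {A B : Type*} [NormedRing A] [NormedAlgebra ℝ A] [NormedRing B] [NormedAlgebra ℝ B]

/-- The entire function `(1 - e^(-z)) / z = ∑ (-1)ⁿ zⁿ / (n+1)!` on a normed algebra. -/
def entireQuot (a : A) : A := ∑' n : ℕ, quotCoeff n • a ^ n

theorem abs_quotCoeff_le (n : ℕ) : |quotCoeff n| ≤ 1 / (n.factorial : ℝ) := by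
  rw [quotCoeff, abs_div, abs_pow, abs_neg, abs_one, one_pow, Nat.abs_cast]
  exact one_div_le_one_div_of_le (by positivity) (by exact_mod_cast Nat.factorial_le n.le_succ)

theorem summable_norm_entireQuot (a : A) : Summable fun n => ‖quotCoeff n • a ^ n‖ := by
  refine Summable.of_nonneg_of_le (fun n => norm_nonneg _) (fun n => ?_)
    ((Real.summable_pow_div_factorial ‖a‖).mul_left (max 1 ‖(1 : A)‖))
  rw [norm_smul, Real.norm_eq_abs]
  -- The power `n = 0` is separate because `‖1‖ ≤ 1` is not assumed in `A`.
  have h1 : ‖a ^ n‖ ≤ max 1 ‖(1 : A)‖ * ‖a‖ ^ n := by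
    rcases n.eq_zero_or_pos with rfl | hn
    · simp
    · refine (norm_pow_le' a hn).trans ?_
      exact le_mul_of_one_le_left (by positivity) (le_max_left _ _)
  calc |quotCoeff n| * ‖a ^ n‖ ≤ 1 / (n.factorial : ℝ) * (max 1 ‖(1 : A)‖ * ‖a‖ ^ n) := by
        gcongr
        exact abs_quotCoeff_le n
    _ = _ := by ring

theorem hasSum_entireQuot [CompleteSpace A] (a : A) :
    HasSum (fun n => quotCoeff n • a ^ n) (entireQuot a) :=
  (summable_norm_entireQuot a).of_norm.hasSum

/-- Transfers `F` between operators, functions on the spectrum and complex numbers. -/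
theorem map_entireQuot [CompleteSpace A] (φ : A →ₐ[ℝ] B) (hφ : Continuous φ)
    (a : A) : φ (entireQuot a) = entireQuot (φ a) := by
  have h := (hasSum_entireQuot a).map φ hφ
  refine h.tsum_eq.symm.trans (tsum_congr fun n => ?_)
  simp

theorem mul_entireQuot_eq [CompleteSpace A] (a : A) :
    a * entireQuot a = 1 - NormedSpace.exp (-a) := by
  have h1 : HasSum (fun n : ℕ => ((n.factorial : ℝ)⁻¹) • (-a) ^ n) (NormedSpace.exp (-a)) :=
    NormedSpace.exp_series_hasSum_exp' (-a)
  have h2 := (hasSum_nat_add_iff' 1).2 h1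
  have h3 := (hasSum_entireQuot a).mul_left (-a)
  have e : (fun n : ℕ => (((n + 1).factorial : ℝ)⁻¹) • (-a) ^ (n + 1))
      = fun n => -a * quotCoeff n • a ^ n := by
    funext n
    rw [quotCoeff, mul_smul_comm, pow_succ', neg_pow a n, div_eq_mul_inv, mul_comm, mul_smul]
    congr 1
    rcases n.even_or_odd with hn | hn <;> simp [hn.neg_one_pow]
  rw [e] at h2
  have h4 := h3.unique h2
  simp only [Finset.range_one, Finset.sum_singleton, pow_zero, Nat.factorial_zero, Nat.cast_one,
    inv_one, one_smul] at h4
  rw [neg_mul, neg_eq_iff_eq_neg, neg_sub] at h4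
  exact h4

theorem mul_entireQuot (z : ℂ) : z * entireQuot z = 1 - Complex.exp (-z) := by
  rw [Complex.exp_eq_exp_ℂ, mul_entireQuot_eq]

/-- For `z = iθ` the chord `|1 - e^(-iθ)|` is at most the arc `|θ|`. -/
theorem norm_entireQuot_le {z : ℂ} (hz : star z = -z) : ‖entireQuot z‖ ≤ 1 := by
  obtain ⟨θ, rfl⟩ : ∃ θ : ℝ, z = θ * Complex.I := by
    refine ⟨z.im, Complex.ext ?_ (by simp)⟩
    have := congrArg Complex.re hz
    simp only [RCLike.star_def, Complex.conj_re, Complex.neg_re] at this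
    simp; linarith
  rcases eq_or_ne θ 0 with rfl | hθ
  · have h : entireQuot (((0 : ℝ) : ℂ) * Complex.I) = 1 := by
      rw [entireQuot, tsum_eq_single 0]
      · simp [quotCoeff]
      · intro n hn; simp [hn]
    rw [h]; simp
  · have h := congrArg norm (mul_entireQuot (θ * Complex.I))
    rw [norm_mul] at h
    have h2 : ‖1 - Complex.exp (-(θ * Complex.I))‖ ≤ ‖(θ * Complex.I : ℂ)‖ := by
      have e : (-(θ * Complex.I) : ℂ) = Complex.I * ((-θ : ℝ) : ℂ) := by push_cast; ring
      rw [norm_sub_rev, e]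
      refine (Real.norm_exp_I_mul_ofReal_sub_one_le).trans ?_
      simp
    have h3 : 0 < ‖(θ * Complex.I : ℂ)‖ := norm_pos_iff.2 (by simpa using hθ)
    rw [← h] at h2
    nlinarith

/-- For `z = iθ` one has `|1 - e^(-iθ) - iθ|² = θ² - 2 (θ sin θ + cos θ - 1)`, and dividing by `θ²`
gives `|F(z) - 1|²`. -/
theorem norm_entireQuot_sub_one_lt {z : ℂ} (hz : star z = -z)
    (hpos : ∀ t, 0 < t → t ≤ ‖z‖ → 0 < t * Real.sin t + Real.cos t - 1) :
    ‖entireQuot z - 1‖ < 1 := by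
  obtain ⟨θ, rfl⟩ : ∃ θ : ℝ, z = θ * Complex.I := by
    refine ⟨z.im, Complex.ext ?_ (by simp)⟩
    have := congrArg Complex.re hz
    simp only [RCLike.star_def, Complex.conj_re, Complex.neg_re] at this
    simp; linarith
  rcases eq_or_ne θ 0 with rfl | hθ
  · have h : entireQuot (((0 : ℝ) : ℂ) * Complex.I) = 1 := by
      rw [entireQuot, tsum_eq_single 0]
      · simp [quotCoeff]
      · intro n hn; simp [hn]
    rw [h]; simp
  · have hn : ‖(θ * Complex.I : ℂ)‖ = |θ| := by simp
    have hp : 0 < |θ| := abs_pos.2 hθ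
    have hp2 : 0 < θ * Real.sin θ + Real.cos θ - 1 := by
      have := hpos |θ| hp hn.ge
      rcases abs_choice θ with h | h <;> rw [h] at this
      · exact this
      · simpa using this
    have h : (θ * Complex.I) * (entireQuot (θ * Complex.I : ℂ) - 1)
        = 1 - Complex.exp (-(θ * Complex.I)) - θ * Complex.I := by
      rw [mul_sub, mul_entireQuot]; ring
    have h' := congrArg norm h
    rw [norm_mul, hn] at h'
    have e : 1 - Complex.exp (-(θ * Complex.I)) - θ * Complex.I
        = ((1 - Real.cos θ : ℝ) : ℂ) + ((Real.sin θ - θ : ℝ) : ℂ) * Complex.I := by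
      rw [← neg_mul, Complex.exp_mul_I, Complex.cos_neg, Complex.sin_neg]
      push_cast; ring
    have h2 : ‖1 - Complex.exp (-(θ * Complex.I)) - θ * Complex.I‖ < |θ| := by
      rw [e]
      refine lt_of_pow_lt_pow_left₀ 2 hp.le ?_
      rw [Complex.sq_norm, Complex.normSq_add_mul_I, sq_abs]
      nlinarith [Real.sin_sq_add_cos_sq θ]
    rw [← h'] at h2
    nlinarith [norm_nonneg (entireQuot (θ * Complex.I : ℂ) - 1)]

/-- After multiplication by `t²` the function becomes `h(t) = t sin t + cos t - 1` with `h' = t cos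
t`. It increases from `0` on `[0, π/2]` and equals `-2` at `π`, so the first positive zero lies
strictly between `π/2` and `π`. -/
theorem exists_isLeast_zero : ∃ r₀ : ℝ,
    IsLeast {t : ℝ | 0 < t ∧ Real.sin t / t + (Real.cos t - 1) / t ^ 2 = 0} r₀ ∧
      Real.pi / 4 < r₀ / 2 ∧ ∀ t, 0 < t → t < r₀ → 0 < t * Real.sin t + Real.cos t - 1 := by
  set h : ℝ → ℝ := fun t => t * Real.sin t + Real.cos t - 1 with hh
  have hc : Continuous h := by fun_prop
  have hd : ∀ t, HasDerivAt h (t * Real.cos t) t := fun t => by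
    have := (((hasDerivAt_id' t).mul (Real.hasDerivAt_sin t)).add
      (Real.hasDerivAt_cos t)).sub_const 1
    rwa [one_mul, add_right_comm, add_neg_cancel, zero_add] at this
  have hmono : StrictMonoOn h (Set.Icc 0 (Real.pi / 2)) := by
    refine strictMonoOn_of_deriv_pos (convex_Icc _ _) hc.continuousOn fun x hx => ?_
    rw [interior_Icc] at hx
    rw [(hd x).deriv]
    exact mul_pos hx.1 (Real.cos_pos_of_mem_Ioo ⟨by linarith [hx.1, Real.pi_pos], hx.2⟩)
  have h0 : h 0 = 0 := by simp [hh]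
  have hpi := Real.pi_pos
  have hsmall : ∀ t, 0 < t → t ≤ Real.pi / 2 → 0 < h t := fun t h1 h2 => by
    have := hmono ⟨le_rfl, by linarith⟩ ⟨h1.le, h2⟩ h1
    rwa [h0] at this
  have hiff : ∀ t : ℝ, 0 < t →
      (Real.sin t / t + (Real.cos t - 1) / t ^ 2 = 0 ↔ h t = 0) := fun t ht => by
    have e : Real.sin t / t + (Real.cos t - 1) / t ^ 2 = h t / t ^ 2 := by
      simp only [hh]; field_simp; ring
    rw [e, div_eq_zero_iff]
    simp [ht.ne']
  have hpineg : h Real.pi < 0 := by simp [hh]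
  let S : Set ℝ := Set.Icc (Real.pi / 2) Real.pi ∩ h ⁻¹' {0}
  have hS : IsCompact S := isCompact_Icc.inter_right (isClosed_singleton.preimage hc)
  have hne : S.Nonempty := by
    obtain ⟨t, ht, h2⟩ := intermediate_value_Icc' (by linarith : Real.pi / 2 ≤ Real.pi)
      hc.continuousOn ⟨hpineg.le, (hsmall _ (by linarith) le_rfl).le⟩
    exact ⟨t, ht, h2⟩
  obtain ⟨r, ⟨⟨hr1, hr2⟩, hr3⟩, hmin⟩ := hS.exists_isLeast hne
  have hr3 : h r = 0 := hr3
  have hlt : Real.pi / 2 < r := by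
    refine lt_of_le_of_ne hr1 fun e => ?_
    have := hsmall _ (by linarith) le_rfl
    rw [e, hr3] at this
    exact this.false
  have hpos : ∀ t, 0 < t → t < r → 0 < h t := by
    intro t h1 h2
    rcases le_total t (Real.pi / 2) with h3 | h3
    · exact hsmall t h1 h3
    -- A nonpositive value at `t < r` would produce a zero in `[π/2, t]`, against the minimality of
    -- `r`.
    by_contra! h4
    obtain ⟨u, hu, hu2⟩ := intermediate_value_Icc' h3 hc.continuousOn
      ⟨h4, (hsmall _ (by linarith) le_rfl).le⟩
    have : r ≤ u := hmin ⟨⟨hu.1, by linarith [hu.2]⟩, hu2⟩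
    linarith [hu.2]
  refine ⟨r, ⟨⟨by linarith, (hiff r (by linarith)).2 hr3⟩, ?_⟩, by linarith, hpos⟩
  rintro t ⟨h1, h2⟩
  by_contra! h3
  exact (hpos t h1 h3).ne' ((hiff t h1).1 h2)

end EntireFunction

/-! ### Normality and norm bounds for `F(ad Z)` -/

section AdjointAction

variable {H : Type*} [NormedAddCommGroup H] [InnerProductSpace ℂ H] [CompleteSpace H]

theorem expQuotient_eq (T : skewHS H →L[ℝ] skewHS H) : expQuotient T = entireQuot T := rfl

/-- The adjoint is `F(-T)`, and power series in `T` commute. -/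
theorem isStarNormal_entireQuot {E : Type*} [NormedAddCommGroup E] [InnerProductSpace ℝ E]
    [CompleteSpace E] {T : E →L[ℝ] E} (hT : star T = -T) : IsStarNormal (entireQuot T) := by
  refine ⟨?_⟩
  have h2 : HasSum (fun n => quotCoeff n • (-T) ^ n) (star (entireQuot T)) := by
    have h : (fun n => quotCoeff n • (-T) ^ n) = fun n => star (quotCoeff n • T ^ n) := by
      funext n
      rw [star_smul, star_pow, hT, star_trivial]
    rw [h]
    exact (hasSum_entireQuot T).star
  rw [← h2.tsum_eq]
  exact Commute.tsum_left _ fun n => Commute.tsum_right _ fun m =>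
    (((Commute.refl T).neg_left.pow_pow n m).smul_left _).smul_right _

theorem isStarNormal_expQuotient (Z : skewHS H) : IsStarNormal (expQuotient (ad Z)) :=
  isStarNormal_entireQuot (star_ad Z)

/-- The functional calculus of the normal operator `ad Z` is isometric, so both bounds are suprema
of `|F|` and `|F - 1|` over its spectrum. Strictness survives because the spectrum is compact. -/
theorem exists_norm_bounds (Z : skewHS H) :
    ‖entireQuot (adHS Z.1)‖ ≤ 1 ∧ ((∀ t, 0 < t → t ≤ ‖adHS Z.1‖ →
      0 < t * Real.sin t + Real.cos t - 1) → ‖entireQuot (adHS Z.1) - 1‖ < 1) := by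
  set a := adHS Z.1 with ha
  have hstar : star a = -a := star_adHS Z
  have hn : IsStarNormal a := ⟨by rw [hstar]; exact (Commute.refl a).neg_left⟩
  let φ := cfcHom (R := ℂ) (a := a) hn
  let i : C(spectrum ℂ a, ℂ) := ContinuousMap.restrict (spectrum ℂ a) (.id ℂ)
  have hi : φ i = a := cfcHom_id hn
  have hφc : Continuous φ := cfcHom_continuous hn
  -- The relation `a* = -a` pulls back to the coordinate function, so the spectrum is purely
  -- imaginary.
  have hspec : ∀ x : spectrum ℂ a, star (x : ℂ) = -x := fun x => by
    have h : φ (star i) = φ (-i) := by rw [map_star, map_neg, hi, hstar]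
    have := cfcHom_injective hn h
    exact congrArg (fun f : C(spectrum ℂ a, ℂ) => f x) this
  have hmap : φ (entireQuot i) = entireQuot a := by
    have := map_entireQuot ((φ : C(spectrum ℂ a, ℂ) →ₐ[ℂ] HSOp H →L[ℂ] HSOp H).restrictScalars ℝ)
      hφc i
    exact this.trans (congrArg entireQuot hi)
  have hnorm : ∀ f, ‖φ f‖ = ‖f‖ := fun f => norm_cfcHom a f hn
  have heval : ∀ x, entireQuot i x = entireQuot (x : ℂ) := fun x =>
    map_entireQuot ((ContinuousMap.evalAlgHom ℂ ℂ x).restrictScalars ℝ)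
      (continuous_eval_const x) i
  constructor
  · rw [← hmap, hnorm, ContinuousMap.norm_le _ zero_le_one]
    intro x
    rw [heval]
    exact norm_entireQuot_le (hspec x)
  · intro hpos
    rw [← hmap, ← map_one φ, ← map_sub, hnorm, ContinuousMap.norm_lt_iff _ one_pos]
    intro x
    have : (entireQuot i - 1) x = entireQuot (x : ℂ) - 1 := by rw [← heval]; rfl
    rw [this]
    refine norm_entireQuot_sub_one_lt (hspec x) fun t h1 h2 => hpos t h1 (h2.trans ?_)
    -- Since `B₂(H)` may be zero, the identity has norm at most `1`, not necessarily equal to `1`.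
    refine (spectrum.norm_le_norm_mul_of_mem x.2).trans ?_
    exact mul_le_of_le_one_right (norm_nonneg _) ContinuousLinearMap.norm_id_le

/-- The real operator `F(ad Z)` is a restriction of the complex one, hence inherits its norm bounds.
-/
theorem coe_entireQuot_ad (Z W : skewHS H) :
    (entireQuot (ad Z) W).1 = entireQuot (adHS Z.1) W.1 := by
  have h1 : HasSum (fun n => ((quotCoeff n • ad Z ^ n) W).1) (entireQuot (ad Z) W).1 :=
    (hasSum_entireQuot (ad Z)).mapL
      ((skewHS H).subtypeL ∘L ContinuousLinearMap.apply ℝ (skewHS H) W)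
  have h2 : HasSum (fun n => (quotCoeff n • adHS Z.1 ^ n) W.1) (entireQuot (adHS Z.1) W.1) :=
    (hasSum_entireQuot (adHS Z.1)).mapL
      ((ContinuousLinearMap.apply ℂ (HSOp H) W.1).restrictScalars ℝ)
  refine h1.unique ?_
  convert h2 using 2 with n
  have h3 : ((ad Z ^ n) W).1 = (adHS Z.1 ^ n) W.1 := by
    induction n with
    | zero => rfl
    | succ n ih => rw [pow_succ', pow_succ', mul_apply_eq_comp, mul_apply_eq_comp, coe_ad, ih]
  rw [_root_.smul_apply, _root_.smul_apply, Submodule.coe_smul, h3]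

theorem norm_expQuotient_le (Z : skewHS H) : ‖expQuotient (ad Z)‖ ≤ 1 := by
  refine ContinuousLinearMap.opNorm_le_bound _ zero_le_one fun W => ?_
  change ‖(entireQuot (ad Z) W).1‖ ≤ 1 * ‖W.1‖
  rw [coe_entireQuot_ad]
  exact (ContinuousLinearMap.le_opNorm _ _).trans (by gcongr; exact (exists_norm_bounds Z).1)

/-- The factor `2` comes from `‖ad Z‖ ≤ 2‖Z‖`; it is what turns `r₀` into `r₀ / 2`. -/
theorem norm_expQuotient_sub_one_lt (Z : skewHS H)
    (hpos : ∀ t, 0 < t → t ≤ 2 * ‖Z.1.op‖ → 0 < t * Real.sin t + Real.cos t - 1) :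
    ‖expQuotient (ad Z) - 1‖ < 1 := by
  refine lt_of_le_of_lt ?_ ((exists_norm_bounds Z).2 fun t h1 h2 =>
    hpos t h1 (h2.trans (norm_adHS_le Z.1)))
  refine ContinuousLinearMap.opNorm_le_bound _ (norm_nonneg _) fun W => ?_
  have : ((expQuotient (ad Z) - 1) W).1 = (entireQuot (adHS Z.1) - 1) W.1 := by
    rw [_root_.sub_apply, _root_.sub_apply, Submodule.coe_sub, expQuotient_eq, coe_entireQuot_ad]
    rfl
  change ‖((expQuotient (ad Z) - 1) W).1‖ ≤ _ * ‖W.1‖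
  rw [this]
  exact ContinuousLinearMap.le_opNorm _ _

end AdjointAction

/-! ### The linear action on triples and the action of `exp Z` on the bundle -/

section Action

variable {H : Type*} [NormedAddCommGroup H] [InnerProductSpace ℂ H] [CompleteSpace H]

variable (H) in
/-- The space of triples `(T, f, c)`, representing the operator `T + c Pp` and the vector `f`. -/
abbrev Aug : Type _ := HSOp H × H × ℝ

theorem isTopologicalRing_endomorphisms (E : Type*) [NormedAddCommGroup E] [NormedSpace ℝ E] :
    IsTopologicalRing (E →L[ℝ] E) := inferInstance

instance : IsTopologicalRing (Aug H →L[ℝ] Aug H) := isTopologicalRing_endomorphisms (Aug H)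

instance : IsTopologicalRing (skewHS H →L[ℝ] skewHS H) :=
  isTopologicalRing_endomorphisms (skewHS H)

variable (Pp : H →L[ℂ] H)

/-- The operator `T + c Pp` represented by a triple `(T, f, c)`. -/
def augOp : Aug H →L[ℝ] (H →L[ℂ] H) :=
  (HSOp.opL.restrictScalars ℝ) ∘L ContinuousLinearMap.fst ℝ (HSOp H) (H × ℝ) +
    (ContinuousLinearMap.snd ℝ H ℝ ∘L ContinuousLinearMap.snd ℝ (HSOp H) (H × ℝ)).smulRight Pp

theorem augOp_apply (x : Aug H) : augOp Pp x = x.1.op + x.2.2 • Pp := rfl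

variable {Pp} in
theorem aug_ext {x y : Aug H} (h1 : augOp Pp x = augOp Pp y) (h2 : x.2.1 = y.2.1)
    (h3 : x.2.2 = y.2.2) : x = y := by
  refine Prod.ext (HSOp.op_injective ?_) (Prod.ext h2 h3)
  rw [augOp_apply, augOp_apply, h3] at h1
  exact add_right_cancel h1

/-- The infinitesimal action `Z • (A, f) = ([Z, A], Z f)` on triples. -/
def infAct : HSOp H →L[ℝ] Aug H →L[ℝ] Aug H :=
  LinearMap.mkContinuous₂ (LinearMap.mk₂ ℝ
    (fun (Z : HSOp H) (x : Aug H) =>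
      ((adHS Z x.1 + x.2.2 • (rmulHS Pp Z - lmulHS Pp Z), Z.op x.2.1, 0) : Aug H))
    (fun Y Z x => by
      refine aug_ext (Pp := Pp) ?_ (by simp) (by simp)
      simp only [augOp_apply, map_add, map_sub, adHS_op, op_smul_real, rmulHS_op, lmulHS_op,
        add_mul, mul_add, smul_add, smul_sub]
      module)
    (fun c Z x => by
      refine aug_ext (Pp := Pp) ?_ (by simp) (by simp)
      simp only [augOp_apply, map_add, map_sub, adHS_op, op_smul_real, rmulHS_op, lmulHS_op,
        Prod.smul_fst, Prod.smul_snd, smul_mul_assoc, mul_smul_comm]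
      module)
    (fun Z x y => by
      refine aug_ext (Pp := Pp) ?_ (by simp) (by simp)
      simp only [augOp_apply, map_add, map_sub, adHS_op, op_smul_real, rmulHS_op, lmulHS_op,
        Prod.fst_add, Prod.snd_add]
      module)
    (fun c Z x => by
      refine aug_ext (Pp := Pp) ?_ (by simp) (by simp)
      simp only [augOp_apply, map_add, map_sub, adHS_op, op_smul_real, rmulHS_op, lmulHS_op,
        Prod.smul_fst, Prod.smul_snd, smul_mul_assoc, mul_smul_comm, smul_eq_mul]
      module))
    (2 + 2 * ‖Pp‖) fun Z x => by
      have hZ := HSOp.opNorm_le Z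
      have hx1 : ‖x.1‖ ≤ ‖x‖ := norm_fst_le x
      have hx2 : ‖x.2.1‖ ≤ ‖x‖ := (norm_fst_le x.2).trans (norm_snd_le x)
      have hx3 : ‖x.2.2‖ ≤ ‖x‖ := (norm_snd_le x.2).trans (norm_snd_le x)
      have hb : ‖adHS Z x.1 + x.2.2 • (rmulHS Pp Z - lmulHS Pp Z)‖
          ≤ (2 + 2 * ‖Pp‖) * ‖Z‖ * ‖x‖ := by
        have h1 : ‖adHS Z x.1‖ ≤ 2 * ‖Z‖ * ‖x‖ :=
          (ContinuousLinearMap.le_of_opNorm_le _ (norm_adHS_le Z) _).trans (by gcongr)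
        have h2 : ‖rmulHS Pp Z - lmulHS Pp Z‖ ≤ 2 * ‖Pp‖ * ‖Z‖ := by
          refine (norm_sub_le _ _).trans ?_
          linarith [ContinuousLinearMap.le_of_opNorm_le _ (norm_rmulHS_le Pp) Z,
            ContinuousLinearMap.le_of_opNorm_le _ (norm_lmulHS_le Pp) Z]
        calc _ ≤ ‖adHS Z x.1‖ + ‖x.2.2‖ * ‖rmulHS Pp Z - lmulHS Pp Z‖ := by
              rw [← norm_smul]; exact norm_add_le _ _
          _ ≤ 2 * ‖Z‖ * ‖x‖ + ‖x‖ * (2 * ‖Pp‖ * ‖Z‖) := by gcongr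
          _ = _ := by ring
      refine norm_prod_le_iff.2 ⟨hb, norm_prod_le_iff.2 ⟨?_, ?_⟩⟩
      · refine (Z.op.le_opNorm x.2.1).trans ?_
        have : ‖Z.op‖ * ‖x.2.1‖ ≤ ‖Z‖ * ‖x‖ := by gcongr
        have h0 : 0 ≤ ‖Z‖ * ‖x‖ := by positivity
        nlinarith [norm_nonneg Pp]
      · simp only [LinearMap.mk₂_apply, norm_zero]
        positivity

@[simp] theorem infAct_vec (Z : HSOp H) (x : Aug H) : (infAct Pp Z x).2.1 = Z.op x.2.1 := rfl
@[simp] theorem infAct_coeff (Z : HSOp H) (x : Aug H) : (infAct Pp Z x).2.2 = 0 := rfl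

theorem augOp_infAct (Z : HSOp H) (x : Aug H) :
    augOp Pp (infAct Pp Z x) = Z.op * augOp Pp x - augOp Pp x * Z.op := by
  have h : (infAct Pp Z x).1 = adHS Z x.1 + x.2.2 • (rmulHS Pp Z - lmulHS Pp Z) := rfl
  rw [augOp_apply, augOp_apply, infAct_coeff, h]
  simp only [map_add, map_sub, adHS_op, op_smul_real, rmulHS_op, lmulHS_op, mul_add, add_mul,
    mul_smul_comm, smul_mul_assoc]
  module

/-- The infinitesimal action represents the Lie algebra. This is the source of the bracket in the
first variation and of `ad Z` in the derivative of the exponential. -/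
theorem infAct_commutator (Y Z : HSOp H) :
    infAct Pp Y * infAct Pp Z - infAct Pp Z * infAct Pp Y = infAct Pp (adHS Y Z) := by
  refine ContinuousLinearMap.ext fun x => aug_ext (Pp := Pp) ?_ ?_ ?_
  · rw [_root_.sub_apply, mul_apply_eq_comp, mul_apply_eq_comp, map_sub]
    simp only [augOp_infAct, adHS_op]
    noncomm_ring
  · simp [mul_apply_eq_comp]
  · simp [mul_apply_eq_comp]

theorem hasDerivAt_exp_smul_mul {A : Type*} [NormedRing A] [NormedAlgebra ℝ A] [CompleteSpace A]
    (Z : A) (t : ℝ) : HasDerivAt (fun u : ℝ => NormedSpace.exp (u • Z))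
      (Z * NormedSpace.exp (t • Z)) t := hasDerivAt_exp_smul_const' Z t

theorem exp_smul_neg_mul_self {A : Type*} [NormedRing A] [NormedAlgebra ℝ A] [CompleteSpace A]
    (Z : A) (t : ℝ) : NormedSpace.exp (t • -Z) * NormedSpace.exp (t • Z) = 1 := by
  let := NormedAlgebra.restrictScalars ℚ ℝ A
  rw [← NormedSpace.exp_add_of_commute
    (((Commute.refl Z).neg_left.smul_left t).smul_right t)]
  simp

theorem exp_smul_mul_neg_self {A : Type*} [NormedRing A] [NormedAlgebra ℝ A] [CompleteSpace A]
    (Z : A) (t : ℝ) : NormedSpace.exp (t • Z) * NormedSpace.exp (t • -Z) = 1 := by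
  have := exp_smul_neg_mul_self (-Z) t
  rwa [neg_neg] at this

/-- Uniqueness of solutions of `y' = Z y - y Z`. -/
theorem eq_conj_of_hasDerivAt {A : Type*} [NormedRing A] [NormedAlgebra ℝ A] [CompleteSpace A]
    {Z : A} {y : ℝ → A} (hy : ∀ t, HasDerivAt y (Z * y t - y t * Z) t) (t : ℝ) :
    y t = NormedSpace.exp (t • Z) * y 0 * NormedSpace.exp (t • -Z) := by
  -- Conjugating a solution back by the flow gives a constant function.
  have hd : ∀ t : ℝ, HasDerivAt (fun u : ℝ => NormedSpace.exp (u • -Z) * y u *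
      NormedSpace.exp (u • Z)) 0 t := fun t => by
    have h := ((hasDerivAt_exp_smul_const (-Z) t).mul (hy t)).mul (hasDerivAt_exp_smul_mul Z t)
    refine h.congr_deriv ?_
    simp only [Pi.mul_apply]
    noncomm_ring
  have hc := is_const_of_deriv_eq_zero (fun u => (hd u).differentiableAt) (fun u => (hd u).deriv)
    t 0
  simp only [zero_smul, NormedSpace.exp_zero, one_mul, mul_one] at hc
  rw [← hc]
  simp only [← mul_assoc, exp_smul_mul_neg_self, one_mul]
  rw [mul_assoc, exp_smul_mul_neg_self, mul_one]

/-- Uniqueness of solutions of `v' = Z v`. -/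
theorem eq_exp_apply_of_hasDerivAt {Z : H →L[ℂ] H} {v : ℝ → H}
    (hv : ∀ t, HasDerivAt v (Z (v t)) t) (t : ℝ) : v t = NormedSpace.exp (t • Z) (v 0) := by
  have hd : ∀ t : ℝ, HasDerivAt (fun u : ℝ => NormedSpace.exp (u • -Z) (v u)) 0 t := fun t => by
    have h := ((ContinuousLinearMap.restrictScalarsL ℂ H H ℝ ℝ).hasFDerivAt.comp_hasDerivAt t
      (hasDerivAt_exp_smul_const (-Z) t)).clm_apply (hv t)
    refine h.congr_deriv ?_
    change (NormedSpace.exp (t • -Z) * -Z) (v t) + NormedSpace.exp (t • -Z) (Z (v t)) = 0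
    rw [mul_apply_eq_comp, _root_.neg_apply, map_neg, neg_add_cancel]
  have hc := is_const_of_deriv_eq_zero (fun u => (hd u).differentiableAt) (fun u => (hd u).deriv)
    t 0
  simp only [zero_smul, NormedSpace.exp_zero, one_apply_eq_self] at hc
  rw [← hc, ← mul_apply_eq_comp, exp_smul_mul_neg_self, one_apply_eq_self]

/-- Solutions of the linear equation `x' = Z • x` on triples. -/
theorem augOp_of_hasDerivAt {Z : HSOp H} {x : ℝ → Aug H}
    (hx : ∀ t, HasDerivAt x (infAct Pp Z (x t)) t) (t : ℝ) :
    augOp Pp (x t) = NormedSpace.exp (t • Z.op) * augOp Pp (x 0) * NormedSpace.exp (t • -Z.op) ∧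
      (x t).2.1 = NormedSpace.exp (t • Z.op) (x 0).2.1 := by
  constructor
  · refine eq_conj_of_hasDerivAt (y := fun t => augOp Pp (x t)) (fun t => ?_) t
    have := (augOp Pp).hasFDerivAt.comp_hasDerivAt t (hx t)
    rw [augOp_infAct] at this
    exact this
  · exact eq_exp_apply_of_hasDerivAt (v := fun t => (x t).2.1) (fun t => (hx t).snd.fst) t

theorem hasDerivAt_exp_smul_apply {E : Type*} [NormedAddCommGroup E] [NormedSpace ℝ E]
    [CompleteSpace E] (A : E →L[ℝ] E) (x : E) (t : ℝ) :
    HasDerivAt (fun u : ℝ => NormedSpace.exp (u • A) x) (A (NormedSpace.exp (t • A) x)) t :=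
  (ContinuousLinearMap.apply ℝ E x).hasFDerivAt.comp_hasDerivAt t (hasDerivAt_exp_smul_mul A t)

theorem exp_zero_smul_apply {E : Type*} [NormedAddCommGroup E] [NormedSpace ℝ E]
    (A : E →L[ℝ] E) (x : E) : NormedSpace.exp ((0 : ℝ) • A) x = x := by
  rw [zero_smul, NormedSpace.exp_zero, one_apply_eq_self]

theorem exp_one_smul_apply {E : Type*} [NormedAddCommGroup E] [NormedSpace ℝ E]
    (A : E →L[ℝ] E) (x : E) : NormedSpace.exp ((1 : ℝ) • A) x = NormedSpace.exp A x := by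
  rw [one_smul]

theorem hasDerivAt_exp_infAct (Z : HSOp H) (x : Aug H) (t : ℝ) :
    HasDerivAt (fun u : ℝ => NormedSpace.exp (u • infAct Pp Z) x)
      (infAct Pp Z (NormedSpace.exp (t • infAct Pp Z) x)) t :=
  hasDerivAt_exp_smul_apply (infAct Pp Z) x t

/-- Both sides are values at time `1` of solutions of the same linear equation; the coefficient `c`
is conserved. -/
theorem exp_infAct (Z : HSOp H) (x : Aug H) :
    augOp Pp (NormedSpace.exp (infAct Pp Z) x)
      = NormedSpace.exp Z.op * augOp Pp x * NormedSpace.exp (-Z.op) ∧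
    (NormedSpace.exp (infAct Pp Z) x).2.1 = NormedSpace.exp Z.op x.2.1 ∧
    (NormedSpace.exp (infAct Pp Z) x).2.2 = x.2.2 := by
  have h := augOp_of_hasDerivAt Pp (hasDerivAt_exp_infAct Pp Z x) 1
  have hd : ∀ t : ℝ, HasDerivAt (fun u : ℝ => (NormedSpace.exp (u • infAct Pp Z) x).2.2) 0 t :=
    fun t => (hasDerivAt_exp_infAct Pp Z x t).snd.snd
  have hc := is_const_of_deriv_eq_zero (fun u => (hd u).differentiableAt) (fun u => (hd u).deriv)
    1 0
  have e0 : NormedSpace.exp ((0 : ℝ) • infAct Pp Z) x = x := exp_zero_smul_apply _ _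
  have e1 : NormedSpace.exp ((1 : ℝ) • infAct Pp Z) x = NormedSpace.exp (infAct Pp Z) x :=
    exp_one_smul_apply _ _
  rw [e0, e1] at hc h
  rw [one_smul, one_smul] at h
  exact ⟨h.1, h.2, hc⟩

/-- `exp T - 1 = T F(-T)`, and the Hilbert-Schmidt operators form an ideal. -/
theorem exp_sub_one_mem {T : H →L[ℂ] H} (hT : T ∈ hsSubmodule H) :
    NormedSpace.exp T - 1 ∈ hsSubmodule H := by
  have h := mul_entireQuot_eq (-T)
  rw [neg_neg] at h
  rw [← neg_sub, ← h]
  exact neg_mem (mul_mem_hs_right _ (neg_mem hT))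

variable {Pp}

/-- The triple `(P - Pp, f, 1)` representing a point of the sphere bundle. -/
def RestrictedBundle.aug (p : RestrictedBundle Pp) : Aug H := (p.emb.1, p.f, 1)

theorem RestrictedBundle.augOp_aug (p : RestrictedBundle Pp) : augOp Pp p.aug = p.P := by
  change (p.P - Pp) + (1 : ℝ) • Pp = p.P
  rw [one_smul, sub_add_cancel]

theorem exp_neg_mul_exp (T : H →L[ℂ] H) : NormedSpace.exp (-T) * NormedSpace.exp T = 1 := by
  have := exp_smul_neg_mul_self T 1
  rwa [one_smul, one_smul] at this

theorem star_exp_skew (Z : skewHS H) : star (NormedSpace.exp Z.1.op) = NormedSpace.exp (-Z.1.op) := by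
  rw [NormedSpace.star_exp, skewHS_star]

/-- The action of `exp Z` on the sphere bundle. -/
def expMove (hPp : IsStarProjection Pp) (Z : skewHS H) (p : RestrictedBundle Pp) :
    RestrictedBundle Pp where
  P := NormedSpace.exp Z.1.op * p.P * NormedSpace.exp (-Z.1.op)
  f := NormedSpace.exp Z.1.op p.f
  isStarProjection := by
    constructor
    · change _ * _ = _
      have : ∀ U V : H →L[ℂ] H, V * U = 1 → U * p.P * V * (U * p.P * V) = U * p.P * V := by
        intro U V h
        calc U * p.P * V * (U * p.P * V) = U * p.P * (V * U) * p.P * V := by noncomm_ring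
          _ = _ := by rw [h, mul_one, mul_assoc U, P_mul_P]
      exact this _ _ (exp_neg_mul_exp _)
    · change star _ = _
      rw [star_mul, star_mul, P_star, star_exp_skew, ← star_exp_skew, star_star, mul_assoc]
  sub_mem := by
    have h1 := exp_sub_one_mem Z.1.op_mem
    have h2 := exp_sub_one_mem (neg_mem Z.1.op_mem)
    have : NormedSpace.exp Z.1.op * p.P * NormedSpace.exp (-Z.1.op) - Pp
        = (NormedSpace.exp Z.1.op - 1) * (p.P * NormedSpace.exp (-Z.1.op))
          + p.P * (NormedSpace.exp (-Z.1.op) - 1) + (p.P - Pp) := by noncomm_ring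
    rw [this]
    exact add_mem (add_mem (mul_mem_hs_right _ h1) (mul_mem_hs_left _ h2)) p.sub_mem
  index_eq_zero := projIndex_conj hPp p.isStarProjection p.sub_mem (exp_neg_mul_exp _)
    (exp_sub_one_mem (neg_mem Z.1.op_mem)) p.index_eq_zero
  apply_eq := by
    change NormedSpace.exp Z.1.op (p.P ((NormedSpace.exp (-Z.1.op) * NormedSpace.exp Z.1.op) p.f))
      = _
    rw [exp_neg_mul_exp, one_apply_eq_self, p.apply_eq]
  norm_eq_one := by
    have h : star (NormedSpace.exp Z.1.op) * NormedSpace.exp Z.1.op = 1 := by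
      rw [star_exp_skew, exp_neg_mul_exp]
    have h2 := ContinuousLinearMap.apply_norm_sq_eq_inner_adjoint_left (NormedSpace.exp Z.1.op) p.f
    rw [← ContinuousLinearMap.star_eq_adjoint, ← ContinuousLinearMap.mul_def, h,
      one_apply_eq_self, inner_self_eq_norm_sq, p.norm_eq_one] at h2
    nlinarith [norm_nonneg (NormedSpace.exp Z.1.op p.f)]

/-- Linearizes the action: smoothness and differentials on the bundle reduce to those of the
exponential of a bounded operator. -/
theorem aug_expMove (hPp : IsStarProjection Pp) (Z : skewHS H) (p : RestrictedBundle Pp) :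
    (expMove hPp Z p).aug = NormedSpace.exp (infAct Pp Z.1) p.aug := by
  obtain ⟨h1, h2, h3⟩ := exp_infAct Pp Z.1 p.aug
  refine aug_ext (Pp := Pp) ?_ h2.symm h3.symm
  rw [h1, p.augOp_aug, RestrictedBundle.augOp_aug]
  rfl

/-- The projection `(T, f, c) ↦ (T, f)`. -/
def augProj : Aug H →L[ℝ] HSOp H × H :=
  (ContinuousLinearMap.fst ℝ (HSOp H) (H × ℝ)).prod
    (ContinuousLinearMap.fst ℝ H ℝ ∘L ContinuousLinearMap.snd ℝ (HSOp H) (H × ℝ))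

theorem augProj_aug (p : RestrictedBundle Pp) : augProj p.aug = p.emb := rfl

/-- The inclusion `(T, f) ↦ (T, f, 0)`. -/
def augIncl : HSOp H × H →L[ℝ] Aug H :=
  (ContinuousLinearMap.fst ℝ (HSOp H) H).prod
    ((ContinuousLinearMap.snd ℝ (HSOp H) H).prod 0)

@[simp] theorem augProj_augIncl (v : HSOp H × H) : augProj (augIncl v) = v := rfl

theorem aug_eq (p : RestrictedBundle Pp) : p.aug = augIncl p.emb + ((0, 0, 1) : Aug H) := by
  refine Prod.ext ?_ (Prod.ext ?_ ?_) <;> simp [RestrictedBundle.aug, augIncl, RestrictedBundle.emb]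

theorem augIncl_delta (p : RestrictedBundle Pp) (Z : skewHS H) :
    augIncl (delta p Z) = infAct Pp Z.1 p.aug := by
  refine aug_ext (Pp := Pp) ?_ rfl rfl
  rw [augOp_infAct, p.augOp_aug, augOp_apply]
  change (Z.1.op * p.P - p.P * Z.1.op) + (0 : ℝ) • Pp = _
  rw [zero_smul, add_zero]

theorem delta_eq_augProj (p : RestrictedBundle Pp) (Z : skewHS H) :
    delta p Z = augProj (infAct Pp Z.1 p.aug) := by
  rw [← augIncl_delta, augProj_augIncl]

end Action

/-! ### An explicit smooth formula for the horizontal lift -/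

section HorizontalLift

variable {H : Type*} [NormedAddCommGroup H] [InnerProductSpace ℂ H] [CompleteSpace H]
variable (Pp : H →L[ℂ] H)

/-- A polynomial formula for the horizontal lift of a vector `(A, g)` at the point represented
by the triple `x`. -/
def liftFormula (x : Aug H) (v : HSOp H × H) : HSOp H :=
  rmulHS (augOp Pp x) v.1 - lmulHS (augOp Pp x) v.1 + rankOneHS (augOp Pp x v.2) x.2.1
    - rankOneHS x.2.1 (augOp Pp x v.2)
    + rankOneHS ((inner ℂ (augOp Pp x v.2) x.2.1 : ℂ) • x.2.1) x.2.1

theorem contDiff_lmulHS : ContDiff ℝ ∞ fun q : (H →L[ℂ] H) × HSOp H => lmulHS q.1 q.2 :=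
  (lmulHS (H := H)).isBoundedBilinearMap.contDiff.restrict_scalars ℝ

theorem contDiff_rmulHS : ContDiff ℝ ∞ fun q : (H →L[ℂ] H) × HSOp H => rmulHS q.1 q.2 :=
  (rmulHS (H := H)).isBoundedBilinearMap.contDiff.restrict_scalars ℝ

theorem contDiff_apply_op : ContDiff ℝ ∞ fun q : (H →L[ℂ] H) × H => q.1 q.2 :=
  (isBoundedBilinearMap_apply (𝕜 := ℂ) (E := H) (F := H)).contDiff.restrict_scalars ℝ

theorem contDiff_rankOneHS : ContDiff ℝ ∞ fun q : H × H => rankOneHS q.1 q.2 :=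
  (rankOneHS (H := H)).isBoundedBilinearMap.contDiff

theorem contDiff_liftFormula {E : Type*} [NormedAddCommGroup E] [NormedSpace ℝ E]
    {x : E → Aug H} {v : E → HSOp H × H} (hx : ContDiff ℝ ∞ x) (hv : ContDiff ℝ ∞ v) :
    ContDiff ℝ ∞ fun e => liftFormula Pp (x e) (v e) := by
  have hP : ContDiff ℝ ∞ fun e => augOp Pp (x e) := (augOp Pp).contDiff.comp hx
  have hf : ContDiff ℝ ∞ fun e => (x e).2.1 := (contDiff_fst.comp contDiff_snd).comp hx
  have hA : ContDiff ℝ ∞ fun e => (v e).1 := contDiff_fst.comp hv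
  have hg : ContDiff ℝ ∞ fun e => (v e).2 := contDiff_snd.comp hv
  have hh : ContDiff ℝ ∞ fun e => augOp Pp (x e) (v e).2 := contDiff_apply_op.comp (hP.prodMk hg)
  have hc : ContDiff ℝ ∞ fun e => (inner ℂ (augOp Pp (x e) (v e).2) (x e).2.1 : ℂ) :=
    hh.inner ℂ hf
  exact ((((contDiff_rmulHS.comp (hP.prodMk hA)).sub (contDiff_lmulHS.comp (hP.prodMk hA))).add
    (contDiff_rankOneHS.comp (hh.prodMk hf))).sub (contDiff_rankOneHS.comp (hf.prodMk hh))).add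
    (contDiff_rankOneHS.comp ((hc.smul hf).prodMk hf))

variable {Pp} (p : RestrictedBundle Pp)

/-- With `L` the projection onto `⟨f⟩`, the commutator of the first component of `δ_p Z` with `P`
restores the blocks of `Z` between `R(P)` and `N(P)`. The rank one terms give `PZL + LZP - LZL`,
that is, the row and column of `f` inside `R(P)`; the last term corrects the corner `LZL`, which is
otherwise counted twice. The other blocks vanish by horizontality. -/
theorem liftFormula_delta {Z : skewHS H} (hZ : Z ∈ horizontalSpace p) :
    liftFormula Pp p.aug (delta p Z) = Z.1 := by
  ext1
  obtain ⟨h1, h2⟩ := hZ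
  have e0 : (delta p Z).1.op = Z.1.op * p.P - p.P * Z.1.op := rfl
  have e1 : InnerProductSpace.rankOne ℂ (p.P (Z.1.op p.f)) p.f = p.P * Z.1.op * lineProj p := by
    ext z; simp [lineProj]
  have e2 : InnerProductSpace.rankOne ℂ p.f (p.P (Z.1.op p.f)) = -(lineProj p * Z.1.op * p.P) := by
    rw [← star_rankOne, e1, star_mul, star_mul, line_star, skewHS_star, P_star]
    noncomm_ring
  have e3 : InnerProductSpace.rankOne ℂ ((inner ℂ (p.P (Z.1.op p.f)) p.f : ℂ) • p.f) p.f
      = -(lineProj p * Z.1.op * lineProj p) := by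
    have h : inner ℂ (p.P (Z.1.op p.f)) p.f = -inner ℂ p.f (Z.1.op p.f) := by
      rw [← ContinuousLinearMap.adjoint_inner_right, ← ContinuousLinearMap.star_eq_adjoint, P_star,
        p.apply_eq, ← ContinuousLinearMap.adjoint_inner_right,
        ← ContinuousLinearMap.star_eq_adjoint, skewHS_star, _root_.neg_apply, inner_neg_right]
    rw [h]
    ext z
    simp [lineProj, InnerProductSpace.rankOne_apply, smul_smul, mul_comm]
  have e4 : (liftFormula Pp p.aug (delta p Z)).op
      = (delta p Z).1.op * p.P - p.P * (delta p Z).1.op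
        + InnerProductSpace.rankOne ℂ (p.P (Z.1.op p.f)) p.f
        - InnerProductSpace.rankOne ℂ p.f (p.P (Z.1.op p.f))
        + InnerProductSpace.rankOne ℂ ((inner ℂ (p.P (Z.1.op p.f)) p.f : ℂ) • p.f) p.f := by
    simp only [liftFormula, p.augOp_aug, map_add, map_sub, lmulHS_op, rmulHS_op, rankOneHS_op]
    rfl
  rw [e4, e0, e1, e2, e3]
  -- `k1` and `k2` are the two horizontality conditions, multiplied out.
  have k1 : p.P * Z.1.op * p.P - p.P * Z.1.op * lineProj p - lineProj p * Z.1.op * p.P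
      + lineProj p * Z.1.op * lineProj p = 0 := by
    rw [← h1]; noncomm_ring
  have k2 : Z.1.op - p.P * Z.1.op - Z.1.op * p.P + p.P * Z.1.op * p.P = 0 := by
    rw [← h2]; noncomm_ring
  have k3 : (Z.1.op * p.P - p.P * Z.1.op) * p.P - p.P * (Z.1.op * p.P - p.P * Z.1.op)
      = Z.1.op * p.P + p.P * Z.1.op - 2 • (p.P * Z.1.op * p.P) := by
    have r1 : Z.1.op * p.P * p.P = Z.1.op * p.P := by rw [mul_assoc, P_mul_P]
    have r2 : p.P * (p.P * Z.1.op) = p.P * Z.1.op := by rw [← mul_assoc, P_mul_P]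
    rw [sub_mul, mul_sub, r1, r2, ← mul_assoc]
    abel
  rw [k3, ← sub_eq_zero, ← neg_eq_zero]
  calc _ = (Z.1.op - p.P * Z.1.op - Z.1.op * p.P + p.P * Z.1.op * p.P)
        + (p.P * Z.1.op * p.P - p.P * Z.1.op * lineProj p - lineProj p * Z.1.op * p.P
          + lineProj p * Z.1.op * lineProj p) := by abel
    _ = 0 := by rw [k1, k2, add_zero]

theorem delta_horizontalLift (V : tangentSpace p) : delta p (horizontalLift p V).1 = V :=
  congrArg Subtype.val ((LinearEquiv.ofBijective (deltaHor p)
    (deltaHor_bijective p)).apply_symm_apply V)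

theorem horizontalLift_eq (V : tangentSpace p) :
    (horizontalLift p V).1.1 = liftFormula Pp p.aug V := by
  rw [← liftFormula_delta p (horizontalLift p V).2, delta_horizontalLift]

theorem horizontalLift_of_eq {V : tangentSpace p} {Z : skewHS H} (hZ : Z ∈ horizontalSpace p)
    (h : delta p Z = V) : (horizontalLift p V).1 = Z := by
  apply Subtype.ext
  rw [horizontalLift_eq, ← h, liftFormula_delta p hZ]

variable (H) in
/-- The orthogonal projection onto the anti-Hermitian operators. -/
def skewProj : HSOp H →L[ℝ] skewHS H := (skewHS H).orthogonalProjectionOnto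

theorem skewProj_coe (Z : skewHS H) : skewProj H Z.1 = Z :=
  Submodule.orthogonalProjectionOnto_mem_subspace_eq_self Z

/-- The horizontal lift of the velocity of a smooth curve. -/
def SmoothCurve.lift (γ : SmoothCurve Pp) (t : ℝ) : skewHS H :=
  (horizontalLift (γ t) (γ.velocity t)).1

theorem SmoothCurve.lift_mem (γ : SmoothCurve Pp) (t : ℝ) : γ.lift t ∈ horizontalSpace (γ t) :=
  (horizontalLift (γ t) (γ.velocity t)).2

theorem SmoothCurve.delta_lift (γ : SmoothCurve Pp) (t : ℝ) :
    delta (γ t) (γ.lift t) = deriv (fun t => (γ t).emb) t :=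
  delta_horizontalLift (γ t) (γ.velocity t)

/-- The lift is already anti-Hermitian, so the projection changes nothing; it only exhibits the lift
as a composition of smooth maps with values in `skewHS H`. -/
theorem SmoothCurve.lift_eq (γ : SmoothCurve Pp) (t : ℝ) :
    γ.lift t = skewProj H (liftFormula Pp (γ t).aug (deriv (fun t => (γ t).emb) t)) := by
  rw [← SmoothCurve.delta_lift, liftFormula_delta _ (γ.lift_mem t), skewProj_coe]

theorem contDiff_aug_of_emb {E : Type*} [NormedAddCommGroup E] [NormedSpace ℝ E]
    {q : E → RestrictedBundle Pp} (hq : ContDiff ℝ ∞ fun e => (q e).emb) :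
    ContDiff ℝ ∞ fun e => (q e).aug := by
  rw [funext fun e => aug_eq (q e)]
  exact (augIncl.contDiff.comp hq).add contDiff_const

theorem SmoothCurve.contDiff_lift (γ : SmoothCurve Pp) : ContDiff ℝ ∞ γ.lift := by
  have h : ContDiff ℝ ∞ (deriv fun t => (γ t).emb) := (contDiff_infty_iff_deriv.1 γ.smooth).2
  rw [show γ.lift = _ from funext γ.lift_eq]
  exact (skewProj H).contDiff.comp (contDiff_liftFormula Pp (contDiff_aug_of_emb γ.smooth) h)

theorem hasDerivAt_aug_of_emb {q : ℝ → RestrictedBundle Pp} {v : HSOp H × H} {t : ℝ}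
    (hd : HasDerivAt (fun t => (q t).emb) v t) : HasDerivAt (fun t => (q t).aug) (augIncl v) t := by
  have h1 : HasDerivAt (fun t => (q t).emb.1) v.1 t := hd.fst
  have h2 : HasDerivAt (fun t => (q t).emb.2) v.2 t := hd.snd
  exact h1.prodMk (h2.prodMk (hasDerivAt_const t (1 : ℝ)))

/-- Every smooth curve solves the linear equation `x' = z(t) • x` whose coefficient is its
horizontal lift. -/
theorem SmoothCurve.hasDerivAt_aug (γ : SmoothCurve Pp) (t : ℝ) :
    HasDerivAt (fun t => (γ t).aug) (infAct Pp (γ.lift t).1 (γ t).aug) t := by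
  have hd : HasDerivAt (fun t => (γ t).emb) (deriv (fun t => (γ t).emb) t) t :=
    ((γ.smooth.differentiable (by simp)) t).hasDerivAt
  have e : infAct Pp (γ.lift t).1 (γ t).aug = augIncl (deriv (fun t => (γ t).emb) t) := by
    rw [← augIncl_delta, SmoothCurve.delta_lift]
  rw [e]
  exact hasDerivAt_aug_of_emb hd

end HorizontalLift

/-! ### Partial derivatives and differentiation under the integral -/

section Calculus

variable {E : Type*} [NormedAddCommGroup E] [NormedSpace ℝ E]

theorem hasDerivAt_slice_fst {X : ℝ × ℝ → E} (hX : ContDiff ℝ ∞ X) (s t : ℝ) :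
    HasDerivAt (fun u => X (u, t)) (fderiv ℝ X (s, t) (1, 0)) s := by
  have h : HasDerivAt (fun u : ℝ => (u, t)) ((1, 0) : ℝ × ℝ) s :=
    (hasDerivAt_id s).prodMk (hasDerivAt_const s t)
  exact ((hX.differentiable (by simp)) (s, t)).hasFDerivAt.comp_hasDerivAt s h

theorem hasDerivAt_slice_snd {X : ℝ × ℝ → E} (hX : ContDiff ℝ ∞ X) (s t : ℝ) :
    HasDerivAt (fun u => X (s, u)) (fderiv ℝ X (s, t) (0, 1)) t := by
  have h : HasDerivAt (fun u : ℝ => (s, u)) ((0, 1) : ℝ × ℝ) t :=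
    (hasDerivAt_const t s).prodMk (hasDerivAt_id t)
  exact ((hX.differentiable (by simp)) (s, t)).hasFDerivAt.comp_hasDerivAt t h

theorem contDiff_fderiv_apply {F : Type*} [NormedAddCommGroup F] [NormedSpace ℝ F] {X : F → E}
    (hX : ContDiff ℝ ∞ X) (v : F) : ContDiff ℝ ∞ fun q => fderiv ℝ X q v :=
  (hX.fderiv_right (m := ∞) (by simp)).clm_apply contDiff_const

/-- Mixed partial derivatives commute. -/
theorem mixed_derivatives_eq {X : ℝ × ℝ → E} (hX : ContDiff ℝ ∞ X) {s t : ℝ} {D₁ D₂ : E}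
    (h₁ : HasDerivAt (fun u => fderiv ℝ X (u, t) (0, 1)) D₁ s)
    (h₂ : HasDerivAt (fun u => fderiv ℝ X (s, u) (1, 0)) D₂ t) : D₁ = D₂ := by
  have hX' : ContDiff ℝ ∞ (fderiv ℝ X) := hX.fderiv_right (by simp)
  have hd : DifferentiableAt ℝ (fderiv ℝ X) (s, t) := (hX'.differentiable (by simp)) _
  have e : ∀ v w : ℝ × ℝ, fderiv ℝ (fun q => fderiv ℝ X q v) (s, t) w
      = fderiv ℝ (fderiv ℝ X) (s, t) w v := fun v w => by
    have := (hd.hasFDerivAt.clm_apply (hasFDerivAt_const v (s, t))).fderiv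
    rw [this]; simp
  have k₁ := h₁.unique (hasDerivAt_slice_fst (contDiff_fderiv_apply hX (0, 1)) s t)
  have k₂ := h₂.unique (hasDerivAt_slice_snd (contDiff_fderiv_apply hX (1, 0)) s t)
  have hsymm : IsSymmSndFDerivAt ℝ X (s, t) :=
    hX.contDiffAt.isSymmSndFDerivAt (by
      rw [minSmoothness_of_isRCLikeNormedField]
      exact ENat.LEInfty.out)
  rw [k₁, k₂, e, e]
  exact hsymm _ _

theorem hasDerivAt_bilinear {F G : Type*} [NormedAddCommGroup F] [NormedSpace ℝ F]
    [NormedAddCommGroup G] [NormedSpace ℝ G] (B : E →L[ℝ] F →L[ℝ] G) {u : ℝ → E} {v : ℝ → F}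
    {u' : E} {v' : F} {t : ℝ} (hu : HasDerivAt u u' t) (hv : HasDerivAt v v' t) :
    HasDerivAt (fun t => B (u t) (v t)) (B u' (v t) + B (u t) v') t :=
  (B.hasFDerivAt.comp_hasDerivAt t hu).clm_apply hv

theorem hasDerivAt_integral_norm_sq {E : Type*} [NormedAddCommGroup E] [InnerProductSpace ℝ E]
    {z : ℝ × ℝ → E} (hz : ContDiff ℝ ∞ z) (a b : ℝ) :
    HasDerivAt (fun s => 1 / 2 * ∫ t in a..b, ‖z (s, t)‖ ^ 2)
      (∫ t in a..b, inner ℝ (z (0, t)) (fderiv ℝ z (0, t) (1, 0))) 0 := by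
  have hz' : ContDiff ℝ ∞ fun q => fderiv ℝ z q (1, 0) := contDiff_fderiv_apply hz (1, 0)
  let F' : ℝ × ℝ → ℝ := fun q => 2 * inner ℝ (z q) (fderiv ℝ z q (1, 0))
  have hF'c : Continuous F' := continuous_const.mul (hz.continuous.inner hz'.continuous)
  -- Compactness of `[-1, 1] × [a, b]` supplies the constant dominating function.
  obtain ⟨C, hC⟩ := ((isCompact_Icc (a := (-1 : ℝ)) (b := 1)).prod
    (isCompact_uIcc (a := a) (b := b))).exists_bound_of_continuousOn hF'c.continuousOn
  have hFc : ∀ s, Continuous fun t => ‖z (s, t)‖ ^ 2 := fun s =>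
    (hz.continuous.comp (by fun_prop)).norm.pow 2
  have hd : ∀ s t, HasDerivAt (fun u => ‖z (u, t)‖ ^ 2) (F' (s, t)) s := fun s t => by
    have h := hasDerivAt_slice_fst hz s t
    exact h.norm_sq
  have key := (intervalIntegral.hasDerivAt_integral_of_dominated_loc_of_deriv_le
    (μ := MeasureTheory.volume) (a := a) (b := b) (F := fun s t => ‖z (s, t)‖ ^ 2)
    (F' := fun s t => F' (s, t)) (x₀ := (0 : ℝ)) (s := Set.Icc (-1) 1) (bound := fun _ => C)
    (Icc_mem_nhds (by norm_num) (by norm_num))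
    (Filter.Eventually.of_forall fun s => (hFc s).aestronglyMeasurable)
    ((hFc 0).intervalIntegrable a b)
    (hF'c.comp (by fun_prop : Continuous fun t : ℝ => ((0 : ℝ), t))).aestronglyMeasurable
    (Filter.Eventually.of_forall fun t ht s hs => hC (s, t) ⟨hs, Set.uIoc_subset_uIcc ht⟩)
    intervalIntegrable_const
    (Filter.Eventually.of_forall fun t _ s _ => hd s t)).2
  refine (key.const_mul (1 / 2)).congr_deriv ?_
  rw [← intervalIntegral.integral_const_mul]
  refine intervalIntegral.integral_congr fun t _ => ?_
  simp only [F']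
  ring

end Calculus

/-! ### First variation of the energy -/

section FirstVariation

variable {H : Type*} [NormedAddCommGroup H] [InnerProductSpace ℂ H] [CompleteSpace H]
variable {Pp : H →L[ℂ] H} {γ : SmoothCurve Pp} {a b : ℝ} {Γ : ℝ → SmoothCurve Pp}

theorem IsVariation.contDiff_lift (hΓ : IsVariation γ a b Γ) :
    ContDiff ℝ ∞ fun q : ℝ × ℝ => (Γ q.1).lift q.2 := by
  have h : (fun q : ℝ × ℝ => (Γ q.1).lift q.2) = fun q => skewProj H (liftFormula Pp
      (Γ q.1 q.2).aug (fderiv ℝ (fun q : ℝ × ℝ => (Γ q.1 q.2).emb) q (0, 1))) := by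
    funext q
    rw [SmoothCurve.lift_eq, (hasDerivAt_slice_snd hΓ.smooth q.1 q.2).deriv]
  rw [h]
  exact (skewProj H).contDiff.comp (contDiff_liftFormula Pp (contDiff_aug_of_emb hΓ.smooth)
    (contDiff_fderiv_apply hΓ.smooth (0, 1)))

theorem IsVariation.fderiv_aug_snd (hΓ : IsVariation γ a b Γ) (q : ℝ × ℝ) :
    fderiv ℝ (fun q : ℝ × ℝ => (Γ q.1 q.2).aug) q (0, 1)
      = infAct Pp ((Γ q.1).lift q.2).1 (Γ q.1 q.2).aug :=
  (hasDerivAt_slice_snd (contDiff_aug_of_emb hΓ.smooth) q.1 q.2).unique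
    ((Γ q.1).hasDerivAt_aug q.2)

theorem HasDerivAt.infAct {Z : ℝ → skewHS H} {Z' : skewHS H} {x : ℝ → Aug H} {x' : Aug H} {t : ℝ}
    (hZ : HasDerivAt Z Z' t) (hx : HasDerivAt x x' t) :
    HasDerivAt (fun t => infAct Pp (Z t).1 (x t)) (infAct Pp Z'.1 (x t) + infAct Pp (Z t).1 x') t :=
  hasDerivAt_bilinear (SphereBundle.infAct Pp ∘L (skewHS H).subtypeL) hZ hx

/-- The first variation of the energy. The variation field may be lifted by any field `W` of
anti-Hermitian operators. -/
theorem IsVariation.hasDerivAt_energy (hΓ : IsVariation γ a b Γ) {W W' : ℝ → skewHS H}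
    (hW : ∀ t, HasDerivAt W (W' t) t)
    (hΓW : ∀ t, HasDerivAt (fun s => (Γ s t).aug) (infAct Pp (W t).1 (γ t).aug) 0) :
    HasDerivAt (fun s => (Γ s).energy a b) (∫ t in a..b, inner ℝ (γ.lift t) (W' t)) 0 := by
  have h0 : ∀ t, Γ 0 t = γ t := fun t => by rw [hΓ.zero]
  have hl : ∀ t, (Γ 0).lift t = γ.lift t := fun t => by rw [hΓ.zero]
  have hX : ContDiff ℝ ∞ fun q : ℝ × ℝ => (Γ q.1 q.2).aug := contDiff_aug_of_emb hΓ.smooth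
  refine (hasDerivAt_integral_norm_sq hΓ.contDiff_lift a b).congr_deriv ?_
  refine intervalIntegral.integral_congr fun t _ => ?_
  set z' := fderiv ℝ (fun q : ℝ × ℝ => (Γ q.1).lift q.2) (0, t) (1, 0) with hz'
  have hz : HasDerivAt (fun s => (Γ s).lift t) z' 0 := hasDerivAt_slice_fst hΓ.contDiff_lift 0 t
  have h₁ := HasDerivAt.infAct (Pp := Pp) hz (hΓW t)
  have h₂ := HasDerivAt.infAct (Pp := Pp) (hW t) (γ.hasDerivAt_aug t)
  have e₁ : (fun s => infAct Pp ((Γ s).lift t).1 (Γ s t).aug)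
      = fun s => fderiv ℝ (fun q : ℝ × ℝ => (Γ q.1 q.2).aug) (s, t) (0, 1) :=
    funext fun s => (hΓ.fderiv_aug_snd (s, t)).symm
  have e₂ : (fun t => infAct Pp (W t).1 (γ t).aug)
      = fun t => fderiv ℝ (fun q : ℝ × ℝ => (Γ q.1 q.2).aug) (0, t) (1, 0) :=
    funext fun t => (hΓW t).unique (hasDerivAt_slice_fst hX 0 t)
  rw [e₁] at h₁
  rw [e₂] at h₂
  -- `∂ₛ(z • x) = ∂ₜ(W • x)` for the triple `x` at `(0, t)`.
  have hmix := mixed_derivatives_eq hX h₁ h₂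
  rw [h0, hl] at hmix
  have hcomm := congrArg (fun A : Aug H →L[ℝ] Aug H => A (γ t).aug)
    (infAct_commutator Pp (γ.lift t).1 (W t).1)
  simp only [_root_.sub_apply, mul_apply_eq_comp] at hcomm
  rw [← coe_ad] at hcomm
  -- Expanding the mixed derivatives leaves `z' - W' + [z, W]` acting as zero on the triple of `γ
  -- t`, which makes it vertical.
  have hvert : delta (γ t) (z' - W' t + ad (γ.lift t) (W t)) = 0 := by
    rw [delta_eq_augProj]
    have : infAct Pp (z' - W' t + ad (γ.lift t) (W t)).1 (γ t).aug = 0 := by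
      rw [Submodule.coe_add, Submodule.coe_sub, map_add, map_sub, _root_.add_apply,
        _root_.sub_apply, ← hcomm, ← sub_eq_zero.2 hmix]
      abel
    rw [this, map_zero]
  have horth := real_inner_eq_zero_of_horizontal (γ t) (γ.lift_mem t) hvert
  rw [inner_add_right, inner_sub_right, real_inner_self_ad, add_zero, sub_eq_zero] at horth
  change inner ℝ ((Γ 0).lift t) z' = _
  rw [hl, horth]

theorem liftFormula_zero (x : Aug H) : liftFormula Pp x 0 = 0 := by
  simp [liftFormula]

/-- Curves with constant horizontal lift of the velocity are geodesics. -/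
theorem isGeodesic_of_lift_const {Z : skewHS H} (h : ∀ t, γ.lift t = Z) : IsGeodesic γ := by
  intro a b _ Γ hΓ
  have h0 : ∀ t, Γ 0 t = γ t := fun t => by rw [hΓ.zero]
  -- The horizontal lift of the variation field, written with the explicit formula so that it is
  -- smooth in `t`.
  let W : ℝ → skewHS H := fun t => skewProj H (liftFormula Pp (γ t).aug
    (fderiv ℝ (fun q : ℝ × ℝ => (Γ q.1 q.2).emb) (0, t) (1, 0)))
  have hWs : ContDiff ℝ ∞ W := by
    refine (skewProj H).contDiff.comp (contDiff_liftFormula Pp (contDiff_aug_of_emb γ.smooth) ?_)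
    exact (contDiff_fderiv_apply hΓ.smooth (1, 0)).comp (contDiff_const.prodMk contDiff_id)
  have hWd : ∀ t, HasDerivAt W (deriv W t) t := fun t =>
    ((hWs.differentiable (by simp)) t).hasDerivAt
  have hΓW : ∀ t, HasDerivAt (fun s => (Γ s t).aug) (infAct Pp (W t).1 (γ t).aug) 0 := by
    intro t
    -- The transversal curve `s ↦ Γ s t` is itself a smooth curve in the bundle, so its velocity at
    -- `0` has `W t` as its lift.
    let σ : SmoothCurve Pp := ⟨fun s => Γ s t, hΓ.smooth.comp (contDiff_id.prodMk contDiff_const)⟩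
    have hσ : σ.lift 0 = W t := by
      rw [SmoothCurve.lift_eq]
      change skewProj H (liftFormula Pp (Γ 0 t).aug (deriv (fun s => (Γ s t).emb) 0)) = W t
      rw [h0, (hasDerivAt_slice_fst hΓ.smooth 0 t).deriv]
    have := σ.hasDerivAt_aug 0
    rw [hσ] at this
    change HasDerivAt (fun s => (Γ s t).aug) (infAct Pp (W t).1 (Γ 0 t).aug) 0 at this
    rwa [h0] at this
  have hW0 : ∀ t, (∀ s, Γ s t = γ t) → W t = 0 := by
    intro t ht
    have hd := hasDerivAt_slice_fst hΓ.smooth 0 t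
    simp only [ht] at hd
    have := hd.unique (hasDerivAt_const 0 _)
    simp only [W]
    rw [this, liftFormula_zero, map_zero]
  refine (hΓ.hasDerivAt_energy hWd hΓW).congr_deriv ?_
  -- For constant `Z` the first variation is a pure boundary term, which vanishes as the end points
  -- are fixed.
  have hint := intervalIntegral.integral_eq_sub_of_hasDerivAt (a := a) (b := b)
    (f := fun t => inner ℝ Z (W t)) (f' := fun t => inner ℝ Z (deriv W t))
    (fun t _ => by simpa using (hasDerivAt_const t Z).inner ℝ (hWd t))
    ((continuous_const.inner (contDiff_infty_iff_deriv.1 hWs).2.continuous).intervalIntegrable a b)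
  simp only [h]
  rw [hint, hW0 a hΓ.left, hW0 b hΓ.right, sub_self]

end FirstVariation

/-! ### The du Bois-Reymond lemma and smoothness of the exponential -/

section DuBoisReymond

/-- A smooth function orthogonal on `[a, b]` to the derivatives of all smooth functions vanishing at
the end points takes the same value at both ends. -/
theorem eq_of_forall_integral_mul_deriv_eq_zero {g : ℝ → ℝ} (hg : ContDiff ℝ ∞ g) {a b : ℝ}
    (hab : a < b) (h : ∀ φ : ℝ → ℝ, ContDiff ℝ ∞ φ → φ a = 0 → φ b = 0 →
      ∫ t in a..b, deriv φ t * g t = 0) : g a = g b := by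
  -- With `c` the mean of `g`, the primitive `φ` of `g - c` vanishes at both ends. Testing with it
  -- gives `∫ (g - c)² = 0`.
  set c : ℝ := (∫ t in a..b, g t) / (b - a) with hc
  have hgc : Continuous fun t => g t - c := hg.continuous.sub continuous_const
  have hi : ∀ f : ℝ → ℝ, Continuous f → IntervalIntegrable f MeasureTheory.volume a b :=
    fun f hf => hf.intervalIntegrable a b
  let φ : ℝ → ℝ := fun t => ∫ u in a..t, (g u - c)
  have hφ : ∀ t, HasDerivAt φ (g t - c) t := fun t => (hgc.integral_hasStrictDerivAt a t).hasDerivAt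
  have hφ' : deriv φ = fun t => g t - c := funext fun t => (hφ t).deriv
  have hφs : ContDiff ℝ ∞ φ := contDiff_infty_iff_deriv.2
    ⟨fun t => (hφ t).differentiableAt, hφ' ▸ hg.sub contDiff_const⟩
  have hφb : ∫ u in a..b, (g u - c) = 0 := by
    rw [intervalIntegral.integral_sub (hi _ hg.continuous) (hi _ continuous_const),
      intervalIntegral.integral_const, hc, smul_eq_mul, mul_div_cancel₀ _ (sub_pos.2 hab).ne',
      sub_self]
  have h0 := h φ hφs intervalIntegral.integral_same hφb
  have h1 : ∫ t in a..b, (g t - c) ^ 2 = 0 := by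
    have e : ∀ t, (g t - c) ^ 2 = deriv φ t * g t - c * (g t - c) := fun t => by rw [hφ']; ring
    simp only [e]
    rw [intervalIntegral.integral_sub (hi _ ?_) (hi (fun t => c * (g t - c)) (continuous_const.mul hgc)),
      intervalIntegral.integral_const_mul, hφb, h0, mul_zero, sub_zero]
    rw [hφ']
    exact hgc.mul hg.continuous
  have hz : ∀ t ∈ Set.Icc a b, g t = c := by
    intro t ht
    by_contra hne
    have := intervalIntegral.integral_pos hab (hgc.pow 2).continuousOn (fun x _ => sq_nonneg _)
      ⟨t, ht, sq_pos_of_ne_zero (sub_ne_zero.2 hne)⟩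
    exact this.ne' h1
  rw [hz a (Set.left_mem_Icc.2 hab.le), hz b (Set.right_mem_Icc.2 hab.le)]

theorem contDiff_normedSpace_exp {A : Type*} [NormedRing A] [NormedAlgebra ℝ A] [CompleteSpace A] :
    ContDiff ℝ ∞ (NormedSpace.exp : A → A) :=
  AnalyticOnNhd.contDiff fun x _ => NormedSpace.exp_analytic x

theorem contDiff_exp_apply {E F : Type*} [NormedAddCommGroup E] [NormedSpace ℝ E] [CompleteSpace E]
    [NormedAddCommGroup F] [NormedSpace ℝ F] {A : F → E →L[ℝ] E} {x : F → E}
    (hA : ContDiff ℝ ∞ A) (hx : ContDiff ℝ ∞ x) :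
    ContDiff ℝ ∞ fun e => NormedSpace.exp (A e) (x e) :=
  (contDiff_normedSpace_exp.comp hA).clm_apply hx

end DuBoisReymond

/-! ### Existence, uniqueness and form of the geodesics -/

section Geodesics

variable {H : Type*} [NormedAddCommGroup H] [InnerProductSpace ℂ H] [CompleteSpace H]
variable {Pp : H →L[ℂ] H} (hPp : IsStarProjection Pp)

theorem expMove_zero (p : RestrictedBundle Pp) : expMove hPp 0 p = p := by
  refine RestrictedBundle.ext ?_ ?_
  · change NormedSpace.exp (0 : H →L[ℂ] H) * p.P * NormedSpace.exp (-(0 : H →L[ℂ] H)) = p.P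
    rw [neg_zero, NormedSpace.exp_zero, one_mul, mul_one]
  · change NormedSpace.exp (0 : H →L[ℂ] H) p.f = p.f
    rw [NormedSpace.exp_zero, one_apply_eq_self]

theorem contDiff_expMove {F : Type*} [NormedAddCommGroup F] [NormedSpace ℝ F]
    {Z : F → skewHS H} {q : F → RestrictedBundle Pp} (hZ : ContDiff ℝ ∞ Z)
    (hq : ContDiff ℝ ∞ fun e => (q e).emb) :
    ContDiff ℝ ∞ fun e => (expMove hPp (Z e) (q e)).emb := by
  have h : (fun e => (expMove hPp (Z e) (q e)).emb)
      = fun e => augProj (NormedSpace.exp (infAct Pp (Z e).1) (q e).aug) := by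
    funext e
    rw [← aug_expMove, augProj_aug]
  rw [h]
  exact augProj.contDiff.comp (contDiff_exp_apply
    ((infAct Pp ∘L (skewHS H).subtypeL).contDiff.comp hZ) (contDiff_aug_of_emb hq))

theorem SmoothCurve.ext_of_apply {γ σ : SmoothCurve Pp} (h : ∀ t, γ t = σ t) : γ = σ := by
  cases γ; cases σ
  congr
  exact funext h

/-- The curve `t ↦ exp (Z t) • γ t`. -/
def SmoothCurve.move (γ : SmoothCurve Pp) {Z : ℝ → skewHS H} (hZ : ContDiff ℝ ∞ Z) :
    SmoothCurve Pp :=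
  ⟨fun t => expMove hPp (Z t) (γ t), contDiff_expMove hPp hZ γ.smooth⟩

theorem hasDerivAt_aug_expMove_smul (Z : skewHS H) (p : RestrictedBundle Pp) (t : ℝ) :
    HasDerivAt (fun s : ℝ => (expMove hPp (s • Z) p).aug)
      (infAct Pp Z.1 (expMove hPp (t • Z) p).aug) t := by
  have e : ∀ s : ℝ, (expMove hPp (s • Z) p).aug = NormedSpace.exp (s • infAct Pp Z.1) p.aug :=
    fun s => by rw [aug_expMove, Submodule.coe_smul, map_smul]
  rw [e, funext e]
  exact hasDerivAt_exp_infAct Pp Z.1 p.aug t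

/-- The velocity of a geodesic has constant horizontal lift. -/
theorem IsGeodesic.lift_const (hPp : IsStarProjection Pp) {γ : SmoothCurve Pp} (hγ : IsGeodesic γ) {a b : ℝ} (hab : a < b) :
    γ.lift a = γ.lift b := by
  refine ext_inner_left ℝ fun X => ?_
  refine eq_of_forall_integral_mul_deriv_eq_zero (g := fun t => inner ℝ X (γ.lift t))
    (contDiff_const.inner ℝ γ.contDiff_lift) hab fun φ hφ ha hb => ?_
  have hs : ∀ s : ℝ, ContDiff ℝ ∞ fun t => s • φ t • X := fun s =>
    (hφ.smul contDiff_const).const_smul s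
  -- The variation `exp (s φ X) • γ` has field lifted by `φ X`; this lift need not be horizontal,
  -- which the first variation formula permits.
  let Γ : ℝ → SmoothCurve Pp := fun s => γ.move hPp (hs s)
  have hend : ∀ t, φ t = 0 → ∀ s, Γ s t = γ t := fun t ht s => by
    change expMove hPp (s • φ t • X) (γ t) = γ t
    rw [ht, zero_smul, smul_zero, expMove_zero]
  have hΓ : IsVariation γ a b Γ :=
    { smooth := contDiff_expMove hPp (Z := fun q : ℝ × ℝ => q.1 • φ q.2 • X)
        (q := fun q : ℝ × ℝ => γ q.2)
        (contDiff_fst.smul ((hφ.comp contDiff_snd).smul contDiff_const))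
        (γ.smooth.comp contDiff_snd)
      zero := SmoothCurve.ext_of_apply fun t => by
        change expMove hPp ((0 : ℝ) • φ t • X) (γ t) = γ t
        rw [zero_smul, expMove_zero]
      left := hend a ha
      right := hend b hb }
  have h1 := hγ a b hab Γ hΓ
  have h2 := hΓ.hasDerivAt_energy (W := fun t => φ t • X) (W' := fun t => deriv φ t • X)
    (fun t => ((hφ.differentiable (by simp)) t).hasDerivAt.smul_const X) (fun t => by
      have := hasDerivAt_aug_expMove_smul hPp (φ t • X) (γ t) 0
      rw [zero_smul, expMove_zero] at this
      exact this)
  rw [← h2.unique h1]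
  refine intervalIntegral.integral_congr fun t _ => ?_
  rw [real_inner_smul_right, real_inner_comm]

theorem expMove_P (Z : skewHS H) (p : RestrictedBundle Pp) : (expMove hPp Z p).P
    = NormedSpace.exp Z.1.op * p.P * NormedSpace.exp (-Z.1.op) := rfl

theorem lineProj_expMove (Z : skewHS H) (p : RestrictedBundle Pp) : lineProj (expMove hPp Z p)
    = NormedSpace.exp Z.1.op * lineProj p * NormedSpace.exp (-Z.1.op) := by
  rw [← star_exp_skew]
  ext z
  simp only [lineProj, mul_apply_eq_comp, InnerProductSpace.rankOne_apply, map_smul,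
    ContinuousLinearMap.star_eq_adjoint, ContinuousLinearMap.adjoint_inner_right]
  rfl

/-- `V Z U = Z`, so conjugating the compressing factors conjugates the whole product. -/
theorem conj_mul_conj_eq_zero {R : Type*} [Ring R] {U V Q Z : R} (hVU : V * U = 1)
    (hZU : U * Z = Z * U) (h : Q * Z * Q = 0) :
    (U * Q * V) * Z * (U * Q * V) = 0 := by
  have hV : V * Z * U = Z := by rw [mul_assoc, ← hZU, ← mul_assoc, hVU, one_mul]
  calc (U * Q * V) * Z * (U * Q * V) = U * (Q * (V * Z * U) * Q) * V := by noncomm_ring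
    _ = 0 := by rw [hV, h, mul_zero, zero_mul]

/-- Horizontal operators remain horizontal under conjugation by operators commuting with them. -/
theorem mem_horizontalSpace_expMove {p : RestrictedBundle Pp} {Z : skewHS H}
    (hZ : Z ∈ horizontalSpace p) (t : ℝ) : Z ∈ horizontalSpace (expMove hPp (t • Z) p) := by
  obtain ⟨h1, h2⟩ := hZ
  have hVU := exp_neg_mul_exp (t • Z).1.op
  have hUV : NormedSpace.exp (t • Z).1.op * NormedSpace.exp (-(t • Z).1.op) = 1 := by
    have := exp_neg_mul_exp (-(t • Z).1.op)
    rwa [neg_neg] at this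
  have hc : NormedSpace.exp (t • Z).1.op * Z.1.op = Z.1.op * NormedSpace.exp (t • Z).1.op := by
    rw [Submodule.coe_smul, op_smul_real]
    exact (((Commute.refl Z.1.op).smul_left t).exp_left).eq
  constructor
  · have := conj_mul_conj_eq_zero hVU hc h1
    rw [expMove_P, lineProj_expMove, ← sub_mul, ← mul_sub]
    exact this
  · have := conj_mul_conj_eq_zero hVU hc h2
    rw [mul_sub, sub_mul, mul_one, hUV] at this
    exact this

/-- The curve `t ↦ exp (t Z) • p`. -/
def expCurve (p : RestrictedBundle Pp) (Z : skewHS H) : SmoothCurve Pp :=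
  ⟨fun t => expMove hPp (t • Z) p, contDiff_expMove hPp (contDiff_id.smul contDiff_const)
    contDiff_const⟩

theorem hasDerivAt_expCurve (p : RestrictedBundle Pp) (Z : skewHS H) (t : ℝ) :
    HasDerivAt (fun t => (expCurve hPp p Z t).emb) (delta (expCurve hPp p Z t) Z) t := by
  rw [delta_eq_augProj]
  exact augProj.hasFDerivAt.comp_hasDerivAt t (hasDerivAt_aug_expMove_smul hPp Z p t)

theorem expCurve_lift {p : RestrictedBundle Pp} {Z : skewHS H} (hZ : Z ∈ horizontalSpace p)
    (t : ℝ) : (expCurve hPp p Z).lift t = Z :=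
  horizontalLift_of_eq _ (mem_horizontalSpace_expMove hPp hZ t) (hasDerivAt_expCurve hPp p Z t).deriv.symm

theorem isGeodesicFrom_expCurve (p : RestrictedBundle Pp) (V : tangentSpace p) :
    IsGeodesicFrom p V (expCurve hPp p (horizontalLift p V).1) := by
  have h0 : expCurve hPp p (horizontalLift p V).1 0 = p := by
    change expMove hPp ((0 : ℝ) • _) p = p
    rw [zero_smul, expMove_zero]
  refine ⟨isGeodesic_of_lift_const (expCurve_lift hPp (horizontalLift p V).2), h0, ?_⟩
  change deriv _ 0 = _
  rw [(hasDerivAt_expCurve hPp p _ 0).deriv, h0, delta_horizontalLift]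

/-- The lift is constant, so the equation of the curve is autonomous and linear, with a unique
solution from the initial point. -/
theorem IsGeodesicFrom.eq_expCurve {p : RestrictedBundle Pp} {V : tangentSpace p}
    {γ : SmoothCurve Pp} (h : IsGeodesicFrom p V γ) :
    γ = expCurve hPp p (horizontalLift p V).1 := by
  obtain ⟨hg, rfl, hV⟩ := h
  have hl : ∀ t, γ.lift t = (horizontalLift (γ 0) V).1 := by
    have h0 : γ.lift 0 = (horizontalLift (γ 0) V).1 := by
      rw [SmoothCurve.lift, Subtype.ext hV]
    intro t
    rw [← h0]
    -- Criticality on intervals on either side of `0` covers positive and negative times.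
    rcases lt_trichotomy 0 t with ht | rfl | ht
    · exact (IsGeodesic.lift_const hPp hg ht).symm
    · rfl
    · exact IsGeodesic.lift_const hPp hg ht
  set Z := (horizontalLift (γ 0) V).1
  have hx : ∀ t, HasDerivAt (fun t => (γ t).aug) (infAct Pp Z.1 (γ t).aug) t := fun t => by
    rw [← hl t]; exact γ.hasDerivAt_aug t
  refine SmoothCurve.ext_of_apply fun t => ?_
  obtain ⟨h1, h2⟩ := augOp_of_hasDerivAt Pp hx t
  rw [RestrictedBundle.augOp_aug, RestrictedBundle.augOp_aug] at h1
  have e : (t • Z).1.op = t • Z.1.op := op_smul_real t Z.1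
  refine RestrictedBundle.ext ?_ ?_
  · change (γ t).P = NormedSpace.exp (t • Z).1.op * (γ 0).P * NormedSpace.exp (-(t • Z).1.op)
    rw [e, h1, smul_neg]
  · change (γ t).f = NormedSpace.exp (t • Z).1.op (γ 0).f
    rw [e]
    exact h2

theorem existsUnique_geodesic (hPp : IsStarProjection Pp) (p : RestrictedBundle Pp) (V : tangentSpace p) :
    ∃! γ : SmoothCurve Pp, IsGeodesicFrom p V γ :=
  ⟨_, isGeodesicFrom_expCurve hPp p V, fun _ h => h.eq_expCurve hPp⟩

theorem riemExp_eq (hPp : IsStarProjection Pp) (p : RestrictedBundle Pp) (V : tangentSpace p) :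
    riemExp p V = expMove hPp (horizontalLift p V).1 p := by
  have h : ∃ γ, IsGeodesicFrom p V γ := (existsUnique_geodesic hPp p V).exists
  rw [riemExp, dif_pos h, h.choose_spec.eq_expCurve hPp]
  change expMove hPp ((1 : ℝ) • _) p = _
  rw [one_smul]

end Geodesics

/-! ### Derivative of the exponential in a Banach algebra -/

section ExpDerivative

variable {A : Type*} [NormedRing A] [NormedAlgebra ℝ A] [CompleteSpace A]

/-- Termwise integration: `∫ tⁿ = 1 / (n + 1)` turns `1 / n!` into `1 / (n + 1)!`. -/
theorem integral_exp_smul_neg (a : A) :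
    ∫ t in (0 : ℝ)..1, NormedSpace.exp (t • -a) = entireQuot a := by
  have hF : ∀ (n : ℕ) (t : ℝ), (n.factorial : ℝ)⁻¹ • (t • -a) ^ n
      = t ^ n • (n.factorial : ℝ)⁻¹ • (-a) ^ n := fun n t => by rw [smul_pow, smul_comm]
  have key := intervalIntegral.hasSum_integral_of_dominated_convergence
    (μ := MeasureTheory.volume) (a := 0) (b := 1)
    (F := fun (n : ℕ) (t : ℝ) => t ^ n • (n.factorial : ℝ)⁻¹ • (-a) ^ n)
    (f := fun t => NormedSpace.exp (t • -a))
    (fun n _ => ‖(n.factorial : ℝ)⁻¹ • (-a) ^ n‖)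
    (fun n => ((continuous_pow n).smul continuous_const).aestronglyMeasurable)
    (fun n => Filter.Eventually.of_forall fun t ht => by
      rw [Set.uIoc_of_le zero_le_one] at ht
      rw [norm_smul, norm_pow, Real.norm_of_nonneg ht.1.le]
      exact mul_le_of_le_one_left (norm_nonneg _) (pow_le_one₀ ht.1.le ht.2))
    (Filter.Eventually.of_forall fun t _ => NormedSpace.norm_expSeries_summable' (𝕂 := ℝ) (-a))
    intervalIntegrable_const
    (Filter.Eventually.of_forall fun t _ => by
      simp only [← hF]
      exact NormedSpace.exp_series_hasSum_exp' (𝕂 := ℝ) (t • -a))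
  refine key.unique ?_
  have e : (fun n : ℕ => ∫ t in (0 : ℝ)..1, t ^ n • (n.factorial : ℝ)⁻¹ • (-a) ^ n)
      = fun n => quotCoeff n • a ^ n := by
    funext n
    have hn : (-a) ^ n = (-1 : ℝ) ^ n • a ^ n := by rw [← smul_pow, neg_one_smul]
    rw [intervalIntegral.integral_smul_const, integral_pow, hn, smul_smul, smul_smul, quotCoeff,
      Nat.factorial_succ]
    congr 1
    push_cast
    field_simp
    simp
  rw [e]
  exact hasSum_entireQuot a

/-- Differentiate `X' = (A₀ + s B) X` in `s` at `0` and exchange the derivatives; the result is an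
inhomogeneous linear equation in `t`. -/
theorem hasDerivAt_exp_smul_apply_right {A₀ B : A} (t : ℝ) :
    HasDerivAt (fun t : ℝ => fderiv ℝ NormedSpace.exp (t • A₀) (t • B))
      (B * NormedSpace.exp (t • A₀)
        + A₀ * fderiv ℝ NormedSpace.exp (t • A₀) (t • B)) t := by
  let X : ℝ × ℝ → A := fun q => NormedSpace.exp (q.2 • (A₀ + q.1 • B))
  have hX : ContDiff ℝ ∞ X := contDiff_normedSpace_exp.comp
    (contDiff_snd.smul (contDiff_const.add (contDiff_fst.smul contDiff_const)))
  have hs : ∀ t : ℝ, HasDerivAt (fun s => X (s, t))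
      (fderiv ℝ NormedSpace.exp (t • A₀) (t • B)) 0 := fun t => by
    have h1 : HasDerivAt (fun s : ℝ => t • (A₀ + s • B)) (t • B) 0 := by
      have h : HasDerivAt (fun s : ℝ => t • (A₀ + s • B)) (t • (1 : ℝ) • B) 0 :=
        (((hasDerivAt_id (0 : ℝ)).smul_const B).const_add A₀).const_smul t
      rwa [one_smul] at h
    have h2 : HasFDerivAt (NormedSpace.exp : A → A) (fderiv ℝ NormedSpace.exp (t • A₀))
        (t • (A₀ + (0 : ℝ) • B)) := by
      rw [zero_smul, add_zero]
      exact ((contDiff_normedSpace_exp.differentiable (by simp)) (t • A₀)).hasFDerivAt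
    exact h2.comp_hasDerivAt 0 h1
  have ht : ∀ s t : ℝ, HasDerivAt (fun t => X (s, t)) ((A₀ + s • B) * X (s, t)) t := fun s t =>
    hasDerivAt_exp_smul_mul (A₀ + s • B) t
  have e1 : (fun s => fderiv ℝ X (s, t) (0, 1)) = fun s => (A₀ + s • B) * X (s, t) :=
    funext fun s => (hasDerivAt_slice_snd hX s t).unique (ht s t)
  have e2 : (fun t => fderiv ℝ X (0, t) (1, 0))
      = fun t : ℝ => fderiv ℝ NormedSpace.exp (t • A₀) (t • B) :=
    funext fun t => (hasDerivAt_slice_fst hX 0 t).unique (hs t)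
  have h1 : HasDerivAt (fun s => fderiv ℝ X (s, t) (0, 1))
      (B * NormedSpace.exp (t • A₀) + A₀ * fderiv ℝ NormedSpace.exp (t • A₀) (t • B)) 0 := by
    rw [e1]
    have hl : HasDerivAt (fun s : ℝ => A₀ + s • B) B 0 := by
      simpa using ((hasDerivAt_id (0 : ℝ)).smul_const B).const_add A₀
    refine (hl.mul (hs t)).congr_deriv ?_
    simp only [X, zero_smul, add_zero]
  have h2 := hasDerivAt_slice_snd (contDiff_fderiv_apply hX (1, 0)) 0 t
  rw [← mixed_derivatives_eq hX h1 h2, e2] at h2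
  exact h2

variable {E : Type*} [NormedAddCommGroup E] [NormedSpace ℝ E] [CompleteSpace E]
  (ρ : E →L[ℝ] A) {a : E →L[ℝ] E} {A₀ : A}

/-- The identity `e^(t ad) = Ad(e^(t A₀))`. The intertwiner `ρ` allows `a` to act on the Lie algebra
while the conjugation takes place in the algebra where it is represented. -/
theorem map_exp_smul_apply (h : ∀ W, ρ (a W) = A₀ * ρ W - ρ W * A₀) (W : E) (t : ℝ) :
    ρ (NormedSpace.exp (t • a) W)
      = NormedSpace.exp (t • A₀) * ρ W * NormedSpace.exp (t • -A₀) := by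
  have hy : ∀ t : ℝ, HasDerivAt (fun t : ℝ => ρ (NormedSpace.exp (t • a) W))
      (A₀ * ρ (NormedSpace.exp (t • a) W) - ρ (NormedSpace.exp (t • a) W) * A₀) t := fun t => by
    rw [← h]
    exact ρ.hasFDerivAt.comp_hasDerivAt t (hasDerivAt_exp_smul_apply a W t)
  have := eq_conj_of_hasDerivAt hy t
  rwa [exp_zero_smul_apply] at this

/-- The derivative of the exponential at `A₀` in the direction of `ρ W`, where `ρ` intertwines `a`
and the commutator with `A₀`. -/
theorem fderiv_exp_map (h : ∀ W, ρ (a W) = A₀ * ρ W - ρ W * A₀) (W : E) :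
    fderiv ℝ NormedSpace.exp A₀ (ρ W) = NormedSpace.exp A₀ * ρ (entireQuot a W) := by
  -- Variation of constants: `Y' = e^(-t A₀) ρ(W) e^(t A₀) = ρ(e^(-t a) W)`, whose integral over
  -- `[0, 1]` is `ρ(F(a) W)`.
  let Y : ℝ → A := fun t => NormedSpace.exp (t • -A₀) *
    fderiv ℝ NormedSpace.exp (t • A₀) (t • ρ W)
  have hY : ∀ t, HasDerivAt Y (ρ (NormedSpace.exp (t • -a) W)) t := fun t => by
    have h1 := (hasDerivAt_exp_smul_const (-A₀) t).mul
      (hasDerivAt_exp_smul_apply_right (A₀ := A₀) (B := ρ W) t)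
    refine h1.congr_deriv ?_
    have h2 := map_exp_smul_apply ρ (a := -a) (A₀ := -A₀) (fun W => by
      rw [_root_.neg_apply, map_neg, h]; noncomm_ring) W t
    rw [h2, neg_neg]
    noncomm_ring
  have hc : Continuous fun t : ℝ => NormedSpace.exp (t • -a) :=
    contDiff_normedSpace_exp.continuous.comp (continuous_id.smul continuous_const)
  let L : (E →L[ℝ] E) →L[ℝ] A := ρ ∘L ContinuousLinearMap.apply ℝ E W
  have h1 := intervalIntegral.integral_eq_sub_of_hasDerivAt (a := 0) (b := 1) (fun t _ => hY t)
    ((L.continuous.comp hc).intervalIntegrable 0 1)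
  have h2 := L.intervalIntegral_comp_comm (hc.intervalIntegrable (μ := MeasureTheory.volume) 0 1)
  rw [integral_exp_smul_neg] at h2
  have h3 : ρ (entireQuot a W) = Y 1 - Y 0 := by rw [← h1]; exact h2.symm
  simp only [Y, zero_smul, map_zero, mul_zero, sub_zero] at h3
  rw [h3, ← mul_assoc]
  have h4 := exp_smul_mul_neg_self A₀ 1
  simp only [one_smul] at h4 ⊢
  rw [h4, one_mul]

end ExpDerivative

/-! ### The differential of the Riemannian exponential -/

section Exponential

theorem exp_mul_map {A E : Type*} [NormedRing A] [NormedAlgebra ℝ A] [CompleteSpace A]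
    [NormedAddCommGroup E] [NormedSpace ℝ E] [CompleteSpace E] (ρ : E →L[ℝ] A) {a : E →L[ℝ] E}
    {A₀ : A} (h : ∀ W, ρ (a W) = A₀ * ρ W - ρ W * A₀) (W : E) :
    NormedSpace.exp A₀ * ρ W = ρ (NormedSpace.exp a W) * NormedSpace.exp A₀ := by
  have h1 := map_exp_smul_apply ρ h W 1
  have h2 := exp_smul_neg_mul_self A₀ 1
  simp only [one_smul] at h1 h2
  rw [h1, mul_assoc, h2, mul_one]

theorem exp_apply_eq_zero_iff {E : Type*} [NormedAddCommGroup E] [NormedSpace ℝ E]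
    [CompleteSpace E] (T : E →L[ℝ] E) (x : E) : NormedSpace.exp T x = 0 ↔ x = 0 := by
  refine ⟨fun h => ?_, fun h => by rw [h, map_zero]⟩
  have h1 := congrArg (fun S : E →L[ℝ] E => S x) (exp_smul_neg_mul_self T 1)
  simpa [h] using h1.symm

/-- The factor `exp (ρ Z)` is moved to the right of `ρ`, at the cost of `e^a`, so that the
derivative becomes the infinitesimal action at the end point. -/
theorem hasFDerivAt_exp_map_apply {E F G : Type*} [NormedAddCommGroup E] [NormedSpace ℝ E]
    [CompleteSpace E] [NormedAddCommGroup F] [NormedSpace ℝ F] [CompleteSpace F]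
    [NormedAddCommGroup G] [NormedSpace ℝ G] (ρ : E →L[ℝ] F →L[ℝ] F) (π : F →L[ℝ] G)
    {a : E →L[ℝ] E} {Z : E} (h : ∀ W, ρ (a W) = ρ Z * ρ W - ρ W * ρ Z) (x : F) :
    HasFDerivAt (fun W => π (NormedSpace.exp (ρ W) x))
      ((π ∘L ρ.flip (NormedSpace.exp (ρ Z) x)) ∘L (NormedSpace.exp a * entireQuot a)) Z := by
  have h1 : HasFDerivAt (NormedSpace.exp : (F →L[ℝ] F) → F →L[ℝ] F)
      (fderiv ℝ NormedSpace.exp (ρ Z)) (ρ Z) :=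
    ((contDiff_normedSpace_exp.differentiable (by simp)) (ρ Z)).hasFDerivAt
  have h2 : HasFDerivAt (fun W => π (NormedSpace.exp (ρ W) x))
      ((π ∘L ContinuousLinearMap.apply ℝ F x) ∘L fderiv ℝ NormedSpace.exp (ρ Z) ∘L ρ) Z :=
    (π ∘L ContinuousLinearMap.apply ℝ F x).hasFDerivAt.comp Z (h1.comp Z ρ.hasFDerivAt)
  refine h2.congr_fderiv (ContinuousLinearMap.ext fun W => ?_)
  change π (fderiv ℝ NormedSpace.exp (ρ Z) (ρ W) x)
    = π (ρ (NormedSpace.exp a (entireQuot a W)) (NormedSpace.exp (ρ Z) x))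
  rw [fderiv_exp_map ρ h, exp_mul_map ρ h]
  rfl

variable {H : Type*} [NormedAddCommGroup H] [InnerProductSpace ℂ H] [CompleteSpace H]
variable {Pp : H →L[ℂ] H}

variable (Pp) in
/-- The infinitesimal action of anti-Hermitian operators. -/
def skewAct : skewHS H →L[ℝ] Aug H →L[ℝ] Aug H := infAct Pp ∘L (skewHS H).subtypeL

theorem skewAct_ad (Z W : skewHS H) :
    skewAct Pp (ad Z W) = skewAct Pp Z * skewAct Pp W - skewAct Pp W * skewAct Pp Z := by
  change infAct Pp (ad Z W).1 = _
  rw [coe_ad, ← infAct_commutator]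
  rfl

/-- `δ_p` as a bounded operator. -/
def deltaL (p : RestrictedBundle Pp) : skewHS H →L[ℝ] HSOp H × H :=
  augProj ∘L (skewAct Pp).flip p.aug

theorem deltaL_apply (p : RestrictedBundle Pp) (Z : skewHS H) : deltaL p Z = delta p Z :=
  (delta_eq_augProj p Z).symm

theorem hasFDerivAt_expMove (hPp : IsStarProjection Pp) (p : RestrictedBundle Pp) (Z : skewHS H) :
    HasFDerivAt (fun W => (expMove hPp W p).emb)
      (deltaL (expMove hPp Z p) ∘L (NormedSpace.exp (ad Z) * entireQuot (ad Z))) Z := by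
  have h := hasFDerivAt_exp_map_apply (skewAct Pp) augProj (skewAct_ad Z) p.aug
  have e : ∀ W : skewHS H, NormedSpace.exp (skewAct Pp W) p.aug = (expMove hPp W p).aug :=
    fun W => (aug_expMove hPp W p).symm
  simp only [e] at h
  exact h

/-- The translation by `exp Z` maps `δ_p W` to `δ_q (exp (ad Z) W)`, where `q = exp Z • p`. -/
theorem delta_expMove_eq_zero_iff (hPp : IsStarProjection Pp) (p : RestrictedBundle Pp)
    (Z W : skewHS H) :
    delta (expMove hPp Z p) (NormedSpace.exp (ad Z) W) = 0 ↔ delta p W = 0 := by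
  have hinj : Function.Injective (augIncl (H := H)) :=
    Function.LeftInverse.injective (g := augProj) augProj_augIncl
  rw [← map_eq_zero_iff augIncl hinj, ← map_eq_zero_iff augIncl hinj (x := delta p W),
    augIncl_delta, augIncl_delta, aug_expMove]
  -- The invertible operator `exp Z` sends the vector `W • p` to `(e^(ad Z) W) • (exp Z • p)`.
  have h := congrArg (fun T : Aug H →L[ℝ] Aug H => T p.aug) (exp_mul_map _ (skewAct_ad (Pp := Pp) Z) W)
  have h1 : NormedSpace.exp (infAct Pp Z.1) (infAct Pp W.1 p.aug)
    = infAct Pp (NormedSpace.exp (ad Z) W).1 (NormedSpace.exp (infAct Pp Z.1) p.aug) := h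
  rw [← h1]
  exact exp_apply_eq_zero_iff _ _

theorem isClosed_horizontalSpace (p : RestrictedBundle Pp) :
    IsClosed (horizontalSpace p : Set (skewHS H)) := by
  have hc : Continuous fun Z : skewHS H => Z.1.op := HSOp.opL.continuous.comp continuous_subtype_val
  exact (isClosed_eq ((continuous_const.mul hc).mul continuous_const) continuous_const).inter
    (isClosed_eq ((continuous_const.mul hc).mul continuous_const) continuous_const)

instance (p : RestrictedBundle Pp) : CompleteSpace (horizontalSpace p) :=
  (isClosed_horizontalSpace p).completeSpace_coe

/-- Vectors orthogonal to the horizontal space are vertical. -/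
theorem delta_eq_zero_of_orthogonal (p : RestrictedBundle Pp) {U : skewHS H}
    (hU : ∀ Z ∈ horizontalSpace p, inner ℝ Z U = 0) : delta p U = 0 := by
  set Y : skewHS H := ⟨HSOp.mk _ (vertOp_mem p U), vertOp_skew p U⟩ with hY
  have hδ : delta p Y = 0 := delta_vertOp p U
  have hh : U - Y ∈ horizontalSpace p := horizontal_sub p U
  have h1 : inner ℝ (U - Y) (U - Y) = 0 := by
    rw [inner_sub_right (U - Y), hU _ hh, real_inner_eq_zero_of_horizontal p hh hδ, sub_zero]
  rw [sub_eq_zero.1 (inner_self_eq_zero.1 h1), hδ]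

/-- The horizontal lift is an isomorphism of Banach spaces. -/
def horizontalLiftL (p : RestrictedBundle Pp) : tangentSpace p ≃L[ℝ] horizontalSpace p where
  toLinearEquiv := horizontalLift p
  continuous_toFun := by
    refine Continuous.subtype_mk (Continuous.subtype_mk (f := fun V => (horizontalLift p V).1.1)
      ?_ fun V => (horizontalLift p V).1.2) fun V => (horizontalLift p V).2
    simp only [horizontalLift_eq]
    exact (contDiff_liftFormula Pp contDiff_const contDiff_id).continuous.comp
      continuous_subtype_val
  continuous_invFun := by
    refine Continuous.subtype_mk (f := fun Z : horizontalSpace p => delta p Z.1) ?_ fun Z => ⟨Z.1, rfl⟩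
    simp only [← deltaL_apply]
    exact (deltaL p).continuous.comp continuous_subtype_val

/-- Completeness of the tangent spaces is what the open mapping theorem needs for a bounded inverse
of the differential. -/
instance (p : RestrictedBundle Pp) : CompleteSpace (tangentSpace p) :=
  (completeSpace_congr (e := (horizontalLiftL p).toEquiv)
    (horizontalLiftL p).isUniformEmbedding).2 inferInstance

/-- If `‖T - 1‖ < 1`, then `δ_p ∘ T` is bijective from the horizontal to the tangent space. -/
theorem exists_unique_horizontal (p : RestrictedBundle Pp) {T : skewHS H →L[ℝ] skewHS H}
    (hT : ‖T - 1‖ < 1) (U : skewHS H) : ∃! W : horizontalSpace p, delta p (T W) = delta p U := by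
  let K := horizontalSpace p
  -- `1 - B` is the compression of `T` to the horizontal space; `‖B‖ ≤ ‖1 - T‖ < 1` makes it
  -- invertible.
  let B : K →L[ℝ] K := K.orthogonalProjectionOnto ∘L (1 - T) ∘L K.subtypeL
  have hB : ‖B‖ < 1 := by
    refine lt_of_le_of_lt ?_ hT
    refine ContinuousLinearMap.opNorm_le_bound _ (norm_nonneg (T - 1)) fun W => ?_
    refine (K.norm_orthogonalProjectionOnto_apply_le _).trans ?_
    exact ((1 - T).le_opNorm W.1).trans_eq (congrArg (· * ‖W‖) (norm_sub_rev 1 T))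
  have hu : Function.Bijective ⇑(1 - B : K →L[ℝ] K) :=
    ContinuousLinearMap.isUnit_iff_bijective.1 (isUnit_one_sub_of_norm_lt_one hB)
  have hpr : ∀ W : K, (1 - B : K →L[ℝ] K) W = K.orthogonalProjectionOnto (T W) := fun W => by
    change W - K.orthogonalProjectionOnto (W.1 - T W.1) = _
    rw [map_sub, Submodule.orthogonalProjectionOnto_mem_subspace_eq_self, sub_sub_cancel]
  -- The kernel of `δ_p` is the orthogonal complement of the horizontal space, so `δ_p` and the
  -- orthogonal projection identify the same operators.
  have hiff : ∀ X Y : skewHS H, delta p X = delta p Y ↔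
      K.orthogonalProjectionOnto X = K.orthogonalProjectionOnto Y := by
    intro X Y
    rw [← sub_eq_zero, ← map_sub, ← sub_eq_zero (b := K.orthogonalProjectionOnto Y), ← map_sub,
      Submodule.orthogonalProjectionOnto_eq_zero_iff, Submodule.mem_orthogonal]
    exact ⟨fun h Z hZ => real_inner_eq_zero_of_horizontal p hZ h, delta_eq_zero_of_orthogonal p⟩
  simp only [hiff, ← hpr]
  exact hu.existsUnique _

/-- The differential of the exponential is an isomorphism. -/
theorem exists_hasFDerivAt_expMove (hPp : IsStarProjection Pp) (p : RestrictedBundle Pp)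
    (V : tangentSpace p) (hF : ‖entireQuot (ad (horizontalLift p V).1) - 1‖ < 1)
    {q : RestrictedBundle Pp} (hq : q = expMove hPp (horizontalLift p V).1 p) :
    ∃ D : tangentSpace p ≃L[ℝ] tangentSpace q,
      HasFDerivAt (fun W : tangentSpace p => (expMove hPp (horizontalLift p W).1 p).emb)
        ((tangentSpace q).subtypeL ∘L (D : tangentSpace p →L[ℝ] _)) V := by
  subst hq
  set Z := (horizontalLift p V).1 with hZ
  set q := expMove hPp Z p with hq
  let κ : tangentSpace p →L[ℝ] skewHS H :=
    (horizontalSpace p).subtypeL ∘L (horizontalLiftL p : tangentSpace p →L[ℝ] horizontalSpace p)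
  let D₀ : tangentSpace p →L[ℝ] HSOp H × H :=
    (deltaL q ∘L (NormedSpace.exp (ad Z) * entireQuot (ad Z))) ∘L κ
  have hD₀ : HasFDerivAt (fun W : tangentSpace p => (expMove hPp (horizontalLift p W).1 p).emb)
      D₀ V := HasFDerivAt.comp (g := fun W : skewHS H => (expMove hPp W p).emb)
        (f := fun W => κ W) V (hasFDerivAt_expMove hPp p Z) κ.hasFDerivAt
  have hval : ∀ W, D₀ W = delta q (NormedSpace.exp (ad Z)
      (entireQuot (ad Z) (horizontalLift p W).1)) := fun W => deltaL_apply q _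
  let D₁ : tangentSpace p →L[ℝ] tangentSpace q :=
    D₀.codRestrict (tangentSpace q) fun W => ⟨_, (hval W).symm⟩
  have hbij : Function.Bijective D₁ := by
    -- Translation by `exp Z` reduces bijectivity at `q` to bijectivity of `δ_p ∘ F(ad Z)` on the
    -- horizontal space at `p`.
    have hsub : ∀ X Y : skewHS H, delta q (NormedSpace.exp (ad Z) X)
        = delta q (NormedSpace.exp (ad Z) Y) ↔ delta p X = delta p Y := fun X Y => by
      rw [← sub_eq_zero, ← map_sub, ← map_sub, delta_expMove_eq_zero_iff, map_sub, sub_eq_zero]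
    constructor
    · intro W₁ W₂ h
      have h1 : D₀ W₁ = D₀ W₂ := congrArg Subtype.val h
      rw [hval, hval, hsub] at h1
      exact (horizontalLift p).injective ((exists_unique_horizontal p hF _).unique h1 rfl)
    · rintro ⟨_, X, rfl⟩
      -- The target `δ_q X` is pulled back to `p` by `e^(-ad Z)` and the equation is solved there.
      obtain ⟨W, hW, -⟩ := exists_unique_horizontal p hF (NormedSpace.exp ((1 : ℝ) • -ad Z) X)
      refine ⟨(horizontalLift p).symm W, Subtype.ext ?_⟩
      change D₀ _ = _
      rw [hval, LinearEquiv.apply_symm_apply, (hsub _ _).2 hW]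
      have h1 := congrArg (fun T : skewHS H →L[ℝ] skewHS H => T X) (exp_smul_mul_neg_self (ad Z) 1)
      have h2 : NormedSpace.exp ((1 : ℝ) • ad Z) (NormedSpace.exp ((1 : ℝ) • -ad Z) X) = X := h1
      have h3 := exp_one_smul_apply (ad Z) (NormedSpace.exp ((1 : ℝ) • -ad Z) X)
      rw [← h3, h2]
  exact ⟨ContinuousLinearEquiv.ofBijective D₁ (LinearMap.ker_eq_bot.2 hbij.1)
    (LinearMap.range_eq_top.2 hbij.2), hD₀⟩

end Exponential

end SphereBundle

end

/-! ### The main theorem -/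

open SphereBundle in
theorem mainTheorem9 {H : Type*} [NormedAddCommGroup H] [InnerProductSpace ℂ H] [CompleteSpace H]
    (Pp : H →L[ℂ] H) (hPp : IsStarProjection Pp) :
    ∃ r₀ : ℝ, IsLeast {t : ℝ | 0 < t ∧ Real.sin t / t + (Real.cos t - 1) / t ^ 2 = 0} r₀ ∧
      Real.pi / 4 < r₀ / 2 ∧
      ∀ p : RestrictedBundle Pp,
        (∀ V : tangentSpace p, ∃! γ : SmoothCurve Pp, IsGeodesicFrom p V γ) ∧
        (∀ V : tangentSpace p,
          let Z : H →L[ℂ] H := (horizontalLift p V).1.1.op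
          (riemExp p V).P = NormedSpace.exp Z * p.P * NormedSpace.exp (-Z) ∧
          (riemExp p V).f = NormedSpace.exp Z p.f) ∧
        (∀ V : tangentSpace p, quotNorm p V < r₀ / 2 →
          ∃ D : tangentSpace p ≃L[ℝ] tangentSpace (riemExp p V),
            HasFDerivAt (fun W : tangentSpace p => (riemExp p W).emb)
              ((tangentSpace (riemExp p V)).subtypeL ∘L (D : tangentSpace p →L[ℝ] _)) V) ∧
        (∀ Z ∈ horizontalSpace p,
          IsStarNormal (expQuotient (ad Z)) ∧ ‖expQuotient (ad Z)‖ ≤ 1 ∧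
          (‖Z.1.op‖ < r₀ / 2 → ‖expQuotient (ad Z) - 1‖ < 1)) := by
  obtain ⟨r₀, hr₀, hpi, hpos⟩ := exists_isLeast_zero
  have hF : ∀ Z : skewHS H, ‖Z.1.op‖ < r₀ / 2 → ‖expQuotient (ad Z) - 1‖ < 1 := fun Z hZ =>
    norm_expQuotient_sub_one_lt Z fun t h1 h2 => hpos t h1 (by linarith)
  refine ⟨r₀, hr₀, hpi, fun p => ⟨existsUnique_geodesic hPp p, fun V => ?_, fun V hV => ?_,
    fun Z _ => ⟨isStarNormal_expQuotient Z, norm_expQuotient_le Z, hF Z⟩⟩⟩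
  · rw [riemExp_eq hPp]
    exact ⟨rfl, rfl⟩
  -- The quotient norm is the Hilbert-Schmidt norm of the lift, which dominates its operator norm.
  · have h := hF (horizontalLift p V).1 ((HSOp.opNorm_le _).trans_lt hV)
    obtain ⟨D, hD⟩ := exists_hasFDerivAt_expMove hPp p V h (riemExp_eq hPp p V)
    refine ⟨D, ?_⟩
    simp only [riemExp_eq hPp p] at hD ⊢
    exact hD
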